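/- **Proposition 3.1.** Let $q\in(0,1)$. Let $\mathcal A$ be the unital $*$-algebra of polynomial functions on $SU_q(2)$: it is generated by $\alpha,\gamma$ with relations $\alpha^*\alpha+\gamma^*\gamma=1$, $\alpha\alpha^*+q^2\gamma^*\gamma=1$, $\gamma^*\gamma=\gamma\gamma^*$, $\alpha\gamma=q\gamma\alpha$, $\alpha\gamma^*=q\gamma^*\alpha$, and has comultiplication $\Delta(\alpha)=\alpha\otimes\alpha-q\gamma^*\otimes\gamma$, $\Delta(\gamma)=\gamma\otimes\alpha+\alpha^*\otimes\gamma$. Let $h$ be the Haar state, i.e. the unital positive functional on $\mathcal A$ with $(\iota\otimes h)\Delta(a)=h(a)1=(h\otimes\iota)\Delta(a)$, and let $H$ be the completion of $\mathcal A$ with respect to $\langle a,b\rangle=h(a^*b)$ (this is $L^2(A,h)$ for $A=C(SU_q(2))$). Let $U_q(\mathfrak{su}_2)$ be the algebra generated by $e,f,k,k^{-1}$ with $kk^{-1}=k^{-1}k=1$, $ke=qek$, $kf=q^{-1}fk$, $ef-fe=\frac{k^2-k^{-2}}{q-q^{-1}}$, with antipode $\hat S(k)=k^{-1}$, $\hat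 S(e)=-q^{-1}e$, $\hat S(f)=-qf$. It is paired with $\mathcal A$ by $(\omega\eta)(a)=(\omega\otimes\eta)\Delta(a)$, $k(ab)=k(a)k(b)$, $e(ab)=e(a)k^{-1}(b)+k(a)e(b)$, $f(ab)=f(a)k^{-1}(b)+k(a)f(b)$ and the values of $k,e,f$ on the matrix $\begin{pmatrix}\alpha&-q\gamma^*\\ \gamma&\alpha^*\end{pmatrix}$, which are $\begin{pmatrix}q^{1/2}&0\\0&q^{-1/2}\end{pmatrix}$, $\begin{pmatrix}0&1\\0&0\end{pmatrix}$, $\begin{pmatrix}0&0\\1&0\end{pmatrix}$. Put $\partial_\omega(a)=(\iota\otimes\omega)\Delta(a)$ and $a\triangleleft\omega=(\omega\otimes\iota)\Delta(a)$. For $n\in\mathbb Z$ let $\mathcal A_n=\{a\in\mathcal A:\partial_k(a)=q^{n/2}a\}$, let $\mathcal B=\mathcal A_0$, and let $L^2(A_n,h)$ be the closure of $\mathcal A_n$ in $H$. Then $\partial_e(\mathcal A_n)\subset\mathcal A_{n+2}$ and $\partial_f(\mathcal A_n)\subset\mathcal A_{n-2}$. On $H_+\oplus H_-=L^2(A_1,h)\oplus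 L^2(A_{-1},h)$ consider the Dirac operator $$D=\begin{pmatrix}0&\partial_e\\ \partial_f&0\end{pmatrix},$$ i.e. the closure of the operator given by this matrix on $\mathcal A_1\oplus\mathcal A_{-1}$, and let the Casimir $$C=fe+\left(\frac{q^{1/2}k-q^{-1/2}k^{-1}}{q-q^{-1}}\right)^2\in U_q(\mathfrak{su}_2)$$ act on $H_+\oplus H_-$ as the closure of the operator $a\mapsto a\triangleleft\hat S^{-1}(C)$ on $\mathcal A_1\oplus\mathcal A_{-1}$. Both operators are closable, so that $D$ and $C$ are well defined, and: (i) $D^2=C$, as unbounded operators (with equality of domains); (ii) for every $b\in\mathcal B$, acting on $H_+\oplus H_-$ by left multiplication, $b$ maps the domain of $D$ into itself, and on this domain $$[D,b]=\begin{pmatrix}0&q^{1/2}\partial_e(b)\\ q^{-1/2}\partial_f(b)&0\end{pmatrix},$$ where $\partial_e(b)\in\mathcal A_2$ and $\partial_f(b)\in\mathcal A_{-2}$ act by left multiplication as bounded operators $H_-\to H_+$ and $H_+\to H_-$. -/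

import Mathlib

noncomputable section

namespace SUq

open scoped TensorProduct ComplexOrder

/-- The deformation parameter `q ∈ (0,1)`. -/
abbrev Param : Type := Set.Ioo (0 : ℝ) 1

/-- `q` as a complex number. -/
def qc (q : Param) : ℂ := ((q : ℝ) : ℂ)

/-- `q^{1/2}` as a complex number. -/
def qh (q : Param) : ℂ := ((Real.sqrt (q : ℝ) : ℝ) : ℂ)

lemma qc_ne_zero (q : Param) : qc q ≠ 0 := by
  have := q.2.1
  simp [qc, this.ne']

lemma qh_ne_zero (q : Param) : qh q ≠ 0 := by
  have := Real.sqrt_pos.2 q.2.1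
  simp [qh, this.ne']

lemma qh_mul_qh (q : Param) : qh q * qh q = qc q := by
  simp only [qh, qc]
  rw [← Complex.ofReal_mul, Real.mul_self_sqrt q.2.1.le]

lemma qh_eq (q : Param) : qh q = qc q * (qh q)⁻¹ := by
  rw [← qh_mul_qh, mul_assoc, mul_inv_cancel₀ (qh_ne_zero q), mul_one]

lemma conj_qc (q : Param) : (starRingEnd ℂ) (qc q) = qc q := by simp [qc]

/-! ### The polynomial algebra of `SU_q(2)` -/

/-- Generators `α, α*, γ, γ*`. -/
inductive PolGen
  | al | als | ga | gas

/-- Elements `a, a', c, c'` of a complex algebra satisfy the relations of `α, α*, γ, γ*`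
in `SU_q(2)` (the five defining relations and the adjoints of the last two). -/
structure PolSat (q : Param) {B : Type*} [Ring B] [Algebra ℂ B] (a a' c c' : B) : Prop where
  rel1 : a' * a + c' * c = 1
  rel2 : a * a' + (qc q ^ 2) • (c' * c) = 1
  rel3 : c' * c = c * c'
  rel4 : a * c = qc q • (c * a)
  rel5 : a * c' = qc q • (c' * a)
  rel4' : c' * a' = qc q • (a' * c')
  rel5' : c * a' = qc q • (a' * c)

/-- The letters of the free algebra. -/
abbrev xal : FreeAlgebra ℂ PolGen := FreeAlgebra.ι ℂ PolGen.al
abbrev xals : FreeAlgebra ℂ PolGen := FreeAlgebra.ι ℂ PolGen.als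
abbrev xga : FreeAlgebra ℂ PolGen := FreeAlgebra.ι ℂ PolGen.ga
abbrev xgas : FreeAlgebra ℂ PolGen := FreeAlgebra.ι ℂ PolGen.gas

/-- The defining relations of the polynomial algebra, in the free algebra. -/
inductive PolRel (q : Param) : FreeAlgebra ℂ PolGen → FreeAlgebra ℂ PolGen → Prop
  | rel1 : PolRel q (xals * xal + xgas * xga) 1
  | rel2 : PolRel q (xal * xals + (qc q ^ 2) • (xgas * xga)) 1
  | rel3 : PolRel q (xgas * xga) (xga * xgas)
  | rel4 : PolRel q (xal * xga) (qc q • (xga * xal))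
  | rel5 : PolRel q (xal * xgas) (qc q • (xgas * xal))
  | rel4' : PolRel q (xgas * xals) (qc q • (xals * xgas))
  | rel5' : PolRel q (xga * xals) (qc q • (xals * xga))

/-- The algebra `𝒜` of polynomial functions on `SU_q(2)`: the universal unital `*`-algebra generated
by `α, γ` subject to the relations of `SU_q(2)`. -/
def Pol (q : Param) : Type := RingQuot (PolRel q)

instance (q : Param) : Ring (Pol q) := inferInstanceAs (Ring (RingQuot (PolRel q)))
instance (q : Param) : Algebra ℂ (Pol q) := inferInstanceAs (Algebra ℂ (RingQuot (PolRel q)))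

namespace Pol

variable {q : Param}

/-- The quotient map from the free algebra. -/
def mk (q : Param) : FreeAlgebra ℂ PolGen →ₐ[ℂ] Pol q := RingQuot.mkAlgHom ℂ (PolRel q)

/-- The generator `α`. -/
def al (q : Param) : Pol q := mk q xal
/-- The generator `α*`. -/
def als (q : Param) : Pol q := mk q xals
/-- The generator `γ`. -/
def ga (q : Param) : Pol q := mk q xga
/-- The generator `γ*`. -/
def gas (q : Param) : Pol q := mk q xgas

lemma mk_rel {x y : FreeAlgebra ℂ PolGen} (h : PolRel q x y) : mk q x = mk q y :=
  RingQuot.mkAlgHom_rel ℂ h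

lemma sat (q : Param) : PolSat q (al q) (als q) (ga q) (gas q) where
  rel1 := by simpa only [al, als, ga, gas, map_add, map_mul, map_smul, map_one] using mk_rel (PolRel.rel1 (q := q))
  rel2 := by simpa only [al, als, ga, gas, map_add, map_mul, map_smul, map_one] using mk_rel (PolRel.rel2 (q := q))
  rel3 := by simpa only [al, als, ga, gas, map_add, map_mul, map_smul, map_one] using mk_rel (PolRel.rel3 (q := q))
  rel4 := by simpa only [al, als, ga, gas, map_add, map_mul, map_smul, map_one] using mk_rel (PolRel.rel4 (q := q))
  rel5 := by simpa only [al, als, ga, gas, map_add, map_mul, map_smul, map_one] using mk_rel (PolRel.rel5 (q := q))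
  rel4' := by simpa only [al, als, ga, gas, map_add, map_mul, map_smul, map_one] using mk_rel (PolRel.rel4' (q := q))
  rel5' := by simpa only [al, als, ga, gas, map_add, map_mul, map_smul, map_one] using mk_rel (PolRel.rel5' (q := q))

section lift
variable {B : Type*} [Ring B] [Algebra ℂ B]

/-- The universal property of `𝒜`. -/
def lift {a a' c c' : B} (h : PolSat q a a' c c') : Pol q →ₐ[ℂ] B :=
  RingQuot.liftAlgHom ℂ ⟨FreeAlgebra.lift ℂ
    (fun g : PolGen => PolGen.casesOn (motive := fun _ => B) g a a' c c'), by
      intro x y hxy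
      cases hxy
      · simpa using h.rel1
      · simpa using h.rel2
      · simpa using h.rel3
      · simpa using h.rel4
      · simpa using h.rel5
      · simpa using h.rel4'
      · simpa using h.rel5'⟩

variable {a a' c c' : B} (h : PolSat q a a' c c')

@[simp] lemma lift_al : lift h (al q) = a := by
  unfold lift al mk
  erw [RingQuot.liftAlgHom_mkAlgHom_apply]; simp
@[simp] lemma lift_als : lift h (als q) = a' := by
  unfold lift als mk
  erw [RingQuot.liftAlgHom_mkAlgHom_apply]; simp
@[simp] lemma lift_ga : lift h (ga q) = c := by
  unfold lift ga mk
  erw [RingQuot.liftAlgHom_mkAlgHom_apply]; simp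
@[simp] lemma lift_gas : lift h (gas q) = c' := by
  unfold lift gas mk
  erw [RingQuot.liftAlgHom_mkAlgHom_apply]; simp

end lift

lemma induct {p : Pol q → Prop} (hs : ∀ z : ℂ, p (algebraMap ℂ (Pol q) z))
    (h1 : p (al q)) (h2 : p (als q)) (h3 : p (ga q)) (h4 : p (gas q))
    (hadd : ∀ x y, p x → p y → p (x + y)) (hmul : ∀ x y, p x → p y → p (x * y))
    (x : Pol q) : p x := by
  obtain ⟨y, rfl⟩ : ∃ y, mk q y = x := RingQuot.mkAlgHom_surjective ℂ (PolRel q) x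
  induction y using FreeAlgebra.induction with
  | grade0 r => rw [AlgHom.commutes]; exact hs r
  | grade1 g => cases g <;> assumption
  | mul a b ha hb => rw [map_mul]; exact hmul _ _ ha hb
  | add a b ha hb => rw [map_add]; exact hadd _ _ ha hb

lemma hom_ext {B : Type*} [Semiring B] [Algebra ℂ B] {f g : Pol q →ₐ[ℂ] B}
    (h1 : f (al q) = g (al q)) (h2 : f (als q) = g (als q))
    (h3 : f (ga q) = g (ga q)) (h4 : f (gas q) = g (gas q)) : f = g := by
  ext x
  induction x using induct with
  | hs z => simp
  | h1 => exact h1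
  | h2 => exact h2
  | h3 => exact h3
  | h4 => exact h4
  | hadd x y hx hy => simp [hx, hy]
  | hmul x y hx hy => simp [hx, hy]

/-! ### The `*`-structure -/

/-- The opposite algebra of `𝒜` with the conjugate scalar multiplication. -/
def ConjOp (q : Param) : Type := (Pol q)ᵐᵒᵖ

instance : Ring (ConjOp q) := inferInstanceAs (Ring (Pol q)ᵐᵒᵖ)
instance : Algebra ℂ (ConjOp q) :=
  RingHom.toAlgebra' ((algebraMap ℂ (Pol q)ᵐᵒᵖ).comp (starRingEnd ℂ))
    (fun c x => Algebra.commutes (A := (Pol q)ᵐᵒᵖ) (starRingEnd ℂ c) x)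

/-- The map from `𝒜` to its conjugate opposite. -/
def ConjOp.of (x : Pol q) : ConjOp q := MulOpposite.op x
/-- The map from the conjugate opposite of `𝒜` to `𝒜`. -/
def ConjOp.un (x : ConjOp q) : Pol q := MulOpposite.unop x

lemma ConjOp.of_mul (x y : Pol q) : ConjOp.of x * ConjOp.of y = ConjOp.of (y * x) := rfl
lemma ConjOp.of_add (x y : Pol q) : ConjOp.of x + ConjOp.of y = ConjOp.of (x + y) := rfl
lemma ConjOp.of_one : (1 : ConjOp q) = ConjOp.of 1 := rfl
lemma ConjOp.smul_of (z : ℂ) (x : Pol q) :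
    z • ConjOp.of x = ConjOp.of ((starRingEnd ℂ z) • x) := by
  rw [Algebra.smul_def, Algebra.smul_def]
  exact (Algebra.commutes (A := (Pol q)ᵐᵒᵖ) (starRingEnd ℂ z) (MulOpposite.op x))

/-- The conjugate linear antiautomorphism `α ↦ α*`, `γ ↦ γ*`, as a homomorphism to the conjugate
opposite algebra. -/
def starHom (q : Param) : Pol q →ₐ[ℂ] ConjOp q :=
  lift (a := ConjOp.of (als q)) (a' := ConjOp.of (al q)) (c := ConjOp.of (gas q))
    (c' := ConjOp.of (ga q)) <| by
    have h := sat q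
    constructor <;>
      simp only [ConjOp.of_mul, ConjOp.of_add, ConjOp.of_one, ConjOp.smul_of, map_pow, conj_qc]
    · rw [h.rel1]
    · rw [h.rel2]
    · rw [h.rel3]
    · rw [h.rel4']
    · rw [h.rel5']
    · rw [h.rel4]
    · rw [h.rel5]

instance : Star (Pol q) := ⟨fun x => (starHom q x).un⟩

lemma star_def' (x : Pol q) : star x = (starHom q x).un := rfl

lemma star_algebraMap' (z : ℂ) :
    star (algebraMap ℂ (Pol q) z) = algebraMap ℂ (Pol q) (starRingEnd ℂ z) := by
  rw [star_def', AlgHom.commutes]; rfl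

@[simp] lemma star_al : star (al q) = als q := by rw [star_def', starHom, lift_al]; rfl
@[simp] lemma star_als : star (als q) = al q := by rw [star_def', starHom, lift_als]; rfl
@[simp] lemma star_ga : star (ga q) = gas q := by rw [star_def', starHom, lift_ga]; rfl
@[simp] lemma star_gas : star (gas q) = ga q := by rw [star_def', starHom, lift_gas]; rfl

lemma star_mul'' (x y : Pol q) : star (x * y) = star y * star x := by
  rw [star_def', map_mul]; rfl
lemma star_add'' (x y : Pol q) : star (x + y) = star x + star y := by
  rw [star_def', map_add]; rfl

instance : StarRing (Pol q) where
  star_involutive x := by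
    induction x using induct with
    | hs z => simp [star_algebraMap']
    | h1 => simp
    | h2 => simp
    | h3 => simp
    | h4 => simp
    | hadd x y hx hy => rw [star_add'', star_add'', hx, hy]
    | hmul x y hx hy => rw [star_mul'', star_mul'', hx, hy]
  star_mul := star_mul''
  star_add := star_add''

instance : StarModule ℂ (Pol q) where
  star_smul z x := by
    rw [Algebra.smul_def, star_mul, star_algebraMap', Algebra.smul_def]
    exact (Algebra.commutes _ _).symm

/-! ### The coalgebra structure -/

/-- The comultiplication `Δ`. -/
def comulHom (q : Param) : Pol q →ₐ[ℂ] Pol q ⊗[ℂ] Pol q :=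
  lift (a := al q ⊗ₜ al q - qc q • (gas q ⊗ₜ ga q))
    (a' := als q ⊗ₜ als q - qc q • (ga q ⊗ₜ gas q))
    (c := ga q ⊗ₜ al q + als q ⊗ₜ ga q)
    (c' := gas q ⊗ₜ als q + al q ⊗ₜ gas q) <| by
    have h := sat q
    have h1 : als q * al q = 1 - gas q * ga q := by rw [← h.rel1]; abel
    have h2 : al q * als q = 1 - (qc q ^ 2) • (gas q * ga q) := by rw [← h.rel2]; abel
    constructor <;>
      simp only [mul_add, add_mul, mul_sub, sub_mul, smul_mul_assoc, mul_smul_comm,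
        Algebra.TensorProduct.tmul_mul_tmul, h1, h2, h.rel3.symm, h.rel4, h.rel5, h.rel4', h.rel5',
        TensorProduct.tmul_sub, TensorProduct.sub_tmul, TensorProduct.tmul_smul,
        ← TensorProduct.smul_tmul', smul_sub, smul_add, Algebra.TensorProduct.one_def] <;>
      module

/-- The counit. -/
def counitHom (q : Param) : Pol q →ₐ[ℂ] ℂ :=
  lift (a := (1 : ℂ)) (a' := 1) (c := 0) (c' := 0) (by constructor <;> simp)

instance : Coalgebra ℂ (Pol q) where
  comul := (comulHom q).toLinearMap
  counit := (counitHom q).toLinearMap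
  coassoc := by
    have : (Algebra.TensorProduct.assoc ℂ ℂ ℂ (Pol q) (Pol q) (Pol q)).toAlgHom.comp
      ((Algebra.TensorProduct.map (comulHom q) (.id ℂ _)).comp (comulHom q))
      = (Algebra.TensorProduct.map (.id ℂ _) (comulHom q)).comp (comulHom q) := by
      apply hom_ext <;> simp [comulHom, TensorProduct.tmul_sub, TensorProduct.sub_tmul,
        TensorProduct.tmul_add, TensorProduct.add_tmul, TensorProduct.tmul_smul,
        ← TensorProduct.smul_tmul', smul_add] <;> module
    exact congrArg AlgHom.toLinearMap this
  rTensor_counit_comp_comul := by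
    have : (Algebra.TensorProduct.map (counitHom q) (.id ℂ _)).comp (comulHom q)
      = (Algebra.TensorProduct.lid ℂ (Pol q)).symm := by
      apply hom_ext <;> simp [comulHom, counitHom]
    exact congrArg AlgHom.toLinearMap this
  lTensor_counit_comp_comul := by
    have : (Algebra.TensorProduct.map (.id ℂ _) (counitHom q)).comp (comulHom q)
      = (Algebra.TensorProduct.rid ℂ ℂ (Pol q)).symm := by
      apply hom_ext <;> simp [comulHom, counitHom]
    exact congrArg AlgHom.toLinearMap this

end Pol

/-! ### The quantized enveloping algebra `U_q(su_2)` -/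

/-- Generators `e, f, k, k⁻¹`. -/
inductive UGen
  | e | f | k | ki

/-- Elements `e, f, k, k'` of a complex algebra satisfy the relations of `e, f, k, k⁻¹` in
`U_q(su_2)`. -/
structure USat (q : Param) {B : Type*} [Ring B] [Algebra ℂ B] (e f k k' : B) : Prop where
  rel1 : k * k' = 1
  rel2 : k' * k = 1
  rel3 : k * e = qc q • (e * k)
  rel4 : k * f = (qc q)⁻¹ • (f * k)
  rel5 : e * f - f * e = (qc q - (qc q)⁻¹)⁻¹ • (k ^ 2 - k' ^ 2)

/-- The letters of the free algebra. -/
abbrev ye : FreeAlgebra ℂ UGen := FreeAlgebra.ι ℂ UGen.e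
abbrev yf : FreeAlgebra ℂ UGen := FreeAlgebra.ι ℂ UGen.f
abbrev yk : FreeAlgebra ℂ UGen := FreeAlgebra.ι ℂ UGen.k
abbrev yki : FreeAlgebra ℂ UGen := FreeAlgebra.ι ℂ UGen.ki

/-- The defining relations of `U_q(su_2)`, in the free algebra. -/
inductive URel (q : Param) : FreeAlgebra ℂ UGen → FreeAlgebra ℂ UGen → Prop
  | rel1 : URel q (yk * yki) 1
  | rel2 : URel q (yki * yk) 1
  | rel3 : URel q (yk * ye) (qc q • (ye * yk))
  | rel4 : URel q (yk * yf) ((qc q)⁻¹ • (yf * yk))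
  | rel5 : URel q (ye * yf - yf * ye) ((qc q - (qc q)⁻¹)⁻¹ • (yk ^ 2 - yki ^ 2))

/-- The algebra `U_q(su_2)`: the universal unital algebra generated by `e, f, k, k⁻¹` subject to the
relations above. (Its involution `k* = k`, `e* = f` is not needed below.) -/
def Uq (q : Param) : Type := RingQuot (URel q)

instance (q : Param) : Ring (Uq q) := inferInstanceAs (Ring (RingQuot (URel q)))
instance (q : Param) : Algebra ℂ (Uq q) := inferInstanceAs (Algebra ℂ (RingQuot (URel q)))

namespace Uq

variable {q : Param}

/-- The quotient map from the free algebra. -/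
def mk (q : Param) : FreeAlgebra ℂ UGen →ₐ[ℂ] Uq q := RingQuot.mkAlgHom ℂ (URel q)

/-- The generator `e`. -/
def e (q : Param) : Uq q := mk q ye
/-- The generator `f`. -/
def f (q : Param) : Uq q := mk q yf
/-- The generator `k`. -/
def k (q : Param) : Uq q := mk q yk
/-- The generator `k⁻¹`. -/
def ki (q : Param) : Uq q := mk q yki

lemma mk_rel {x y : FreeAlgebra ℂ UGen} (h : URel q x y) : mk q x = mk q y :=
  RingQuot.mkAlgHom_rel ℂ h

lemma sat (q : Param) : USat q (e q) (f q) (k q) (ki q) where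
  rel1 := by simpa only [e, f, k, ki, map_mul, map_one] using mk_rel (URel.rel1 (q := q))
  rel2 := by simpa only [e, f, k, ki, map_mul, map_one] using mk_rel (URel.rel2 (q := q))
  rel3 := by simpa only [e, f, k, ki, map_mul, map_smul] using mk_rel (URel.rel3 (q := q))
  rel4 := by simpa only [e, f, k, ki, map_mul, map_smul] using mk_rel (URel.rel4 (q := q))
  rel5 := by
    simpa only [e, f, k, ki, map_sub, map_pow, map_mul, map_smul]
      using mk_rel (URel.rel5 (q := q))

section lift
variable {B : Type*} [Ring B] [Algebra ℂ B]

/-- The universal property of `U_q(su_2)`. -/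
def lift {x y z w : B} (h : USat q x y z w) : Uq q →ₐ[ℂ] B :=
  RingQuot.liftAlgHom ℂ ⟨FreeAlgebra.lift ℂ
    (fun g : UGen => UGen.casesOn (motive := fun _ => B) g x y z w), by
      intro a b hab
      cases hab
      · simpa using h.rel1
      · simpa using h.rel2
      · simpa using h.rel3
      · simpa using h.rel4
      · simpa using h.rel5⟩

variable {x y z w : B} (h : USat q x y z w)

@[simp] lemma lift_e : lift h (e q) = x := by
  unfold lift e mk
  erw [RingQuot.liftAlgHom_mkAlgHom_apply]; simp
@[simp] lemma lift_f : lift h (f q) = y := by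
  unfold lift f mk
  erw [RingQuot.liftAlgHom_mkAlgHom_apply]; simp
@[simp] lemma lift_k : lift h (k q) = z := by
  unfold lift k mk
  erw [RingQuot.liftAlgHom_mkAlgHom_apply]; simp
@[simp] lemma lift_ki : lift h (ki q) = w := by
  unfold lift ki mk
  erw [RingQuot.liftAlgHom_mkAlgHom_apply]; simp

end lift

lemma induct {p : Uq q → Prop} (hs : ∀ z : ℂ, p (algebraMap ℂ (Uq q) z))
    (h1 : p (e q)) (h2 : p (f q)) (h3 : p (k q)) (h4 : p (ki q))
    (hadd : ∀ x y, p x → p y → p (x + y)) (hmul : ∀ x y, p x → p y → p (x * y))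
    (x : Uq q) : p x := by
  obtain ⟨y, rfl⟩ : ∃ y, mk q y = x := RingQuot.mkAlgHom_surjective ℂ (URel q) x
  induction y using FreeAlgebra.induction with
  | grade0 r => rw [AlgHom.commutes]; exact hs r
  | grade1 g => cases g <;> assumption
  | mul a b ha hb => rw [map_mul]; exact hmul _ _ ha hb
  | add a b ha hb => rw [map_add]; exact hadd _ _ ha hb

/-- For `c ≠ 0`, the antiautomorphism `k ↦ k⁻¹`, `e ↦ -c e`, `f ↦ -c⁻¹ f` of `U_q(su_2)`. -/
def twist (q : Param) (c : ℂ) (hc : c ≠ 0) : Uq q →ₐ[ℂ] (Uq q)ᵐᵒᵖ :=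
  lift (x := .op ((-c) • e q)) (y := .op ((-c⁻¹) • f q)) (z := .op (ki q)) (w := .op (k q)) <| by
    have h := sat q
    have key : ∀ (x : Uq q) (t : ℂ), k q * x = t • (x * k q) → x * ki q = t • (ki q * x) := by
      intro x t hx
      calc x * ki q = (ki q * k q) * x * ki q := by rw [h.rel2, one_mul]
        _ = ki q * (k q * x) * ki q := by noncomm_ring
        _ = t • (ki q * x * (k q * ki q)) := by rw [hx]; simp [mul_assoc]
        _ = _ := by rw [h.rel1, mul_one]
    have h3 := key _ _ h.rel3
    have h4 := key _ _ h.rel4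
    constructor
    · rw [← MulOpposite.op_mul, h.rel1]; rfl
    · rw [← MulOpposite.op_mul, h.rel2]; rfl
    · rw [← MulOpposite.op_mul, ← MulOpposite.op_mul, ← MulOpposite.op_smul]
      congr 1
      rw [smul_mul_assoc, h3, mul_smul_comm, smul_comm]
    · rw [← MulOpposite.op_mul, ← MulOpposite.op_mul, ← MulOpposite.op_smul]
      congr 1
      rw [smul_mul_assoc, h4, mul_smul_comm, smul_comm]
    · rw [← MulOpposite.op_mul, ← MulOpposite.op_mul, ← MulOpposite.op_pow, ← MulOpposite.op_pow,
        ← MulOpposite.op_sub, ← MulOpposite.op_sub, ← MulOpposite.op_smul]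
      congr 1
      simp only [smul_mul_assoc, mul_smul_comm, smul_smul, neg_mul_neg, inv_mul_cancel₀ hc,
        mul_inv_cancel₀ hc, one_smul]
      rw [← neg_sub (e q * f q), h.rel5, ← smul_neg, neg_sub]

/-- The antipode `Ŝ`, with `Ŝ(k) = k⁻¹`, `Ŝ(e) = -q⁻¹ e`, `Ŝ(f) = -q f`, as an
antihomomorphism. -/
def antipode (q : Param) : Uq q →ₐ[ℂ] (Uq q)ᵐᵒᵖ := twist q (qc q)⁻¹ (inv_ne_zero (qc_ne_zero q))

/-- The inverse `Ŝ⁻¹` of the antipode. -/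
def antipodeInv (q : Param) : Uq q →ₐ[ℂ] (Uq q)ᵐᵒᵖ := twist q (qc q) (qc_ne_zero q)

lemma antipode_antipodeInv (x : Uq q) : (antipode q (antipodeInv q x).unop).unop = x := by
  have := qc_ne_zero q
  induction x using induct with
  | hs z => simp
  | h1 => simp [antipode, antipodeInv, twist, smul_smul, this]
  | h2 => simp [antipode, antipodeInv, twist, smul_smul, this]
  | h3 => simp [antipode, antipodeInv, twist]
  | h4 => simp [antipode, antipodeInv, twist]
  | hadd x y hx hy => simp [hx, hy]
  | hmul x y hx hy => simp [hx, hy]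

lemma antipodeInv_antipode (x : Uq q) : (antipodeInv q (antipode q x).unop).unop = x := by
  have := qc_ne_zero q
  induction x using induct with
  | hs z => simp
  | h1 => simp [antipode, antipodeInv, twist, smul_smul, this]
  | h2 => simp [antipode, antipodeInv, twist, smul_smul, this]
  | h3 => simp [antipode, antipodeInv, twist]
  | h4 => simp [antipode, antipodeInv, twist]
  | hadd x y hx hy => simp [hx, hy]
  | hmul x y hx hy => simp [hx, hy]

/-- The Casimir element `C = f e + ((q^{1/2} k - q^{-1/2} k⁻¹) / (q - q⁻¹))²`. -/
def casimir (q : Param) : Uq q :=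
  f q * e q + ((qc q - (qc q)⁻¹)⁻¹ • (qh q • k q - (qh q)⁻¹ • ki q)) ^ 2

end Uq

/-! ### The pairing of `U_q(su_2)` with `𝒜` and the induced actions -/

/-- The algebra `M(𝒜̂)` of all linear functionals on `𝒜`, with the convolution product
`(ω η)(a) = (ω ⊗ η)(Δ a)`. -/
abbrev Dual (q : Param) : Type := WithConv (Pol q →ₗ[ℂ] ℂ)

/-- The character of `𝒜` given by `k` in the fundamental representation:
`(u_ij) ↦ diag(q^{1/2}, q^{-1/2})`. -/
def kChar (q : Param) : Pol q →ₐ[ℂ] ℂ :=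
  Pol.lift (a := qh q) (a' := (qh q)⁻¹) (c := 0) (c' := 0) <| by
    have := qh_ne_zero q
    constructor <;> simp [this]

/-- The character of `𝒜` given by `k⁻¹` in the fundamental representation. -/
def kiChar (q : Param) : Pol q →ₐ[ℂ] ℂ :=
  Pol.lift (a := (qh q)⁻¹) (a' := qh q) (c := 0) (c' := 0) <| by
    have := qh_ne_zero q
    constructor <;> simp [this]

/-- The homomorphism `a ↦ !![k(a), d(a); 0, k⁻¹(a)]` to upper triangular matrices, for the functional
`d` with `d(ab) = d(a) k⁻¹(b) + k(a) d(b)`, `d(α) = d(α*) = 0`, `d(γ) = x`, `d(γ*) = y`. This is the rule imposed by `Δ̂(d) = d ⊗ k⁻¹ + k ⊗ d`. -/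
def skewHom (q : Param) (x y : ℂ) : Pol q →ₐ[ℂ] Matrix (Fin 2) (Fin 2) ℂ :=
  Pol.lift (a := !![qh q, 0; 0, (qh q)⁻¹]) (a' := !![(qh q)⁻¹, 0; 0, qh q])
    (c := !![0, x; 0, 0]) (c' := !![0, y; 0, 0]) <| by
    have h0 := qh_ne_zero q
    have h1 := qh_eq q
    have h2 : ∀ z : ℂ, qh q * z = qc q * (z * (qh q)⁻¹) := fun z => by
      rw [← qh_mul_qh]; field_simp
    have h3 : ∀ z : ℂ, z * qh q = qc q * ((qh q)⁻¹ * z) := fun z => by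
      rw [← qh_mul_qh]; field_simp
    constructor <;> ext i j <;> fin_cases i <;> fin_cases j <;>
      simp [Matrix.mul_apply, h0] <;> first | exact h2 _ | exact h3 _

/-- The functional `d` on `𝒜` with `d(ab) = d(a) k⁻¹(b) + k(a) d(b)`, `d(α) = d(α*) = 0`,
`d(γ) = x`, `d(γ*) = y`. -/
def skew (q : Param) (x y : ℂ) : Pol q →ₗ[ℂ] ℂ :=
  Matrix.entryLinearMap ℂ ℂ (0 : Fin 2) (1 : Fin 2) ∘ₗ (skewHom q x y).toLinearMap

variable {q : Param}

lemma skewHom_apply (x y : ℂ) (a : Pol q) :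
    skewHom q x y a = !![kChar q a, skew q x y a; 0, kiChar q a] := by
  have : ∀ i j, skewHom q x y a i j = (!![kChar q a, skew q x y a; 0, kiChar q a] :
      Matrix (Fin 2) (Fin 2) ℂ) i j := by
    have h01 : skewHom q x y a 0 1 = skew q x y a := rfl
    have h : skewHom q x y a 0 0 = kChar q a ∧ skewHom q x y a 1 0 = 0 ∧
        skewHom q x y a 1 1 = kiChar q a := by
      induction a using Pol.induct with
      | hs z => simp [Matrix.algebraMap_matrix_apply]
      | h1 => simp [skewHom, kChar, kiChar]
      | h2 => simp [skewHom, kChar, kiChar]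
      | h3 => simp [skewHom, kChar, kiChar]
      | h4 => simp [skewHom, kChar, kiChar]
      | hadd a b ha hb =>
        have ha := ha rfl; have hb := hb rfl
        simp [ha, hb]
      | hmul a b ha hb =>
        have ha := ha rfl; have hb := hb rfl
        simp [Matrix.mul_apply, ha, hb]
    intro i j
    fin_cases i <;> fin_cases j <;> simp [h, h01]
  ext i j; exact this i j

lemma skew_mul (x y : ℂ) (a b : Pol q) :
    skew q x y (a * b) = skew q x y a * kiChar q b + kChar q a * skew q x y b := by
  have h : skew q x y (a * b) = (skewHom q x y a * skewHom q x y b) 0 1 := by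
    rw [← map_mul]; rfl
  rw [h, skewHom_apply, skewHom_apply]
  simp [Matrix.mul_apply]
  ring

lemma skew_algebraMap (x y z : ℂ) : skew q x y (algebraMap ℂ (Pol q) z) = 0 := by
  simp [skew, Matrix.algebraMap_matrix_apply]

@[simp] lemma skew_al (x y : ℂ) : skew q x y (Pol.al q) = 0 := by simp [skew, skewHom]
@[simp] lemma skew_als (x y : ℂ) : skew q x y (Pol.als q) = 0 := by simp [skew, skewHom]
@[simp] lemma skew_ga (x y : ℂ) : skew q x y (Pol.ga q) = x := by simp [skew, skewHom]
@[simp] lemma skew_gas (x y : ℂ) : skew q x y (Pol.gas q) = y := by simp [skew, skewHom]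
@[simp] lemma kChar_al : kChar q (Pol.al q) = qh q := by simp [kChar]
@[simp] lemma kChar_als : kChar q (Pol.als q) = (qh q)⁻¹ := by simp [kChar]
@[simp] lemma kChar_ga : kChar q (Pol.ga q) = 0 := by simp [kChar]
@[simp] lemma kChar_gas : kChar q (Pol.gas q) = 0 := by simp [kChar]
@[simp] lemma kiChar_al : kiChar q (Pol.al q) = (qh q)⁻¹ := by simp [kiChar]
@[simp] lemma kiChar_als : kiChar q (Pol.als q) = qh q := by simp [kiChar]
@[simp] lemma kiChar_ga : kiChar q (Pol.ga q) = 0 := by simp [kiChar]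
@[simp] lemma kiChar_gas : kiChar q (Pol.gas q) = 0 := by simp [kiChar]

/-- Convolution of two functionals, before composing with `Δ`. -/
def pairT (φ ψ : Pol q →ₗ[ℂ] ℂ) : Pol q ⊗[ℂ] Pol q →ₗ[ℂ] ℂ :=
  LinearMap.mul' ℂ ℂ ∘ₗ TensorProduct.map φ ψ

lemma conv_apply (φ ψ : Pol q →ₗ[ℂ] ℂ) (a : Pol q) :
    (WithConv.toConv φ * WithConv.toConv ψ : Dual q) a = pairT φ ψ (Pol.comulHom q a) := rfl

lemma pairT_mul {φ φ₁ φ₁' φ₂ φ₂' ψ ψ₁ ψ₁' ψ₂ ψ₂' : Pol q →ₗ[ℂ] ℂ}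
    (hφ : ∀ a b, φ (a * b) = φ₁ a * φ₁' b + φ₂ a * φ₂' b)
    (hψ : ∀ a b, ψ (a * b) = ψ₁ a * ψ₁' b + ψ₂ a * ψ₂' b) (x y : Pol q ⊗[ℂ] Pol q) :
    pairT φ ψ (x * y) = pairT φ₁ ψ₁ x * pairT φ₁' ψ₁' y + pairT φ₁ ψ₂ x * pairT φ₁' ψ₂' y
      + pairT φ₂ ψ₁ x * pairT φ₂' ψ₁' y + pairT φ₂ ψ₂ x * pairT φ₂' ψ₂' y := by
  induction x with
  | zero => simp
  | add x x' hx hx' => simp only [add_mul, map_add, hx, hx']; ring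
  | tmul a b =>
    induction y with
    | zero => simp
    | add y y' hy hy' => simp only [mul_add, map_add, hy, hy']; ring
    | tmul c d => simp [pairT, hφ, hψ]; ring

lemma char_mul (χ : Pol q →ₐ[ℂ] ℂ) (a b : Pol q) :
    χ.toLinearMap (a * b) = χ.toLinearMap a * χ.toLinearMap b
      + (0 : Pol q →ₗ[ℂ] ℂ) a * (0 : Pol q →ₗ[ℂ] ℂ) b := by simp

lemma skew_mul' (x y : ℂ) (a b : Pol q) :
    skew q x y (a * b) = skew q x y a * (kiChar q).toLinearMap b
      + (kChar q).toLinearMap a * skew q x y b := skew_mul x y a b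

/-- `k ∈ M(𝒜̂)`. -/
def kDual (q : Param) : Dual q := WithConv.toConv (kChar q).toLinearMap
/-- `k⁻¹ ∈ M(𝒜̂)`. -/
def kiDual (q : Param) : Dual q := WithConv.toConv (kiChar q).toLinearMap
/-- `e ∈ M(𝒜̂)`; on the fundamental corepresentation `(α, -qγ*; γ, α*)` it is `(0, 1; 0, 0)`, and
`e(ab) = e(a) k⁻¹(b) + k(a) e(b)`. -/
def eDual (q : Param) : Dual q := WithConv.toConv (skew q 0 (-(qc q)⁻¹))
/-- `f ∈ M(𝒜̂)`; on the fundamental corepresentation `(α, -qγ*; γ, α*)` it is `(0, 0; 1, 0)`, and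
`f(ab) = f(a) k⁻¹(b) + k(a) f(b)`. -/
def fDual (q : Param) : Dual q := WithConv.toConv (skew q 1 0)

@[simp] lemma pairT_zero_left (ψ : Pol q →ₗ[ℂ] ℂ) : pairT 0 ψ = 0 := by
  ext; simp [pairT]
@[simp] lemma pairT_zero_right (ψ : Pol q →ₗ[ℂ] ℂ) : pairT ψ 0 = 0 := by
  ext; simp [pairT]
@[simp] lemma pairT_tmul (φ ψ : Pol q →ₗ[ℂ] ℂ) (a b : Pol q) :
    pairT φ ψ (a ⊗ₜ b) = φ a * ψ b := by simp [pairT]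

lemma dual_sat (q : Param) : USat q (eDual q) (fDual q) (kDual q) (kiDual q) := by
  have h0 := qc_ne_zero q
  have h1 := qh_ne_zero q
  have h2 := qh_eq q
  have hq : qc q = qh q ^ 2 := by rw [sq, qh_mul_qh]
  have hd : qc q - (qc q)⁻¹ ≠ 0 := by
    have h01 := q.2
    have : ((q : ℝ) : ℝ) - (q : ℝ)⁻¹ ≠ 0 := by
      have h3 : 1 < (q : ℝ)⁻¹ := (one_lt_inv₀ h01.1).2 h01.2
      have := h01.2
      linarith
    simpa [qc] using (by exact_mod_cast this : (((q : ℝ) - (q : ℝ)⁻¹ : ℝ) : ℂ) ≠ 0)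
  have hi : (qh q)⁻¹ * (qh q)⁻¹ = (qc q)⁻¹ := by rw [← mul_inv, qh_mul_qh]
  have hqq : qc q * (qc q)⁻¹ = 1 := mul_inv_cancel₀ h0
  have kki : ∀ a : Pol q, pairT (kChar q).toLinearMap (kiChar q).toLinearMap (Pol.comulHom q a)
      = Pol.counitHom q a := by
    intro a
    induction a using Pol.induct with
    | hs z => rw [AlgHom.commutes]; simp [Algebra.TensorProduct.algebraMap_apply]
    | h1 => simp [Pol.comulHom, Pol.counitHom, h1]
    | h2 => simp [Pol.comulHom, Pol.counitHom, h1]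
    | h3 => simp [Pol.comulHom, Pol.counitHom]
    | h4 => simp [Pol.comulHom, Pol.counitHom]
    | hadd a b ha hb => simp only [map_add, ha, hb]
    | hmul a b ha hb =>
      simp only [map_mul, pairT_mul (char_mul _) (char_mul _), ha, hb]; simp
  have kik : ∀ a : Pol q, pairT (kiChar q).toLinearMap (kChar q).toLinearMap (Pol.comulHom q a)
      = Pol.counitHom q a := by
    intro a
    induction a using Pol.induct with
    | hs z => rw [AlgHom.commutes]; simp [Algebra.TensorProduct.algebraMap_apply]
    | h1 => simp [Pol.comulHom, Pol.counitHom, h1]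
    | h2 => simp [Pol.comulHom, Pol.counitHom, h1]
    | h3 => simp [Pol.comulHom, Pol.counitHom]
    | h4 => simp [Pol.comulHom, Pol.counitHom]
    | hadd a b ha hb => simp only [map_add, ha, hb]
    | hmul a b ha hb =>
      simp only [map_mul, pairT_mul (char_mul _) (char_mul _), ha, hb]; simp
  have ks : ∀ (x y z : ℂ), (x = 0 ∧ z = qc q ∨ y = 0 ∧ z = (qc q)⁻¹) → ∀ a : Pol q,
      pairT (kChar q).toLinearMap (skew q x y) (Pol.comulHom q a)
      = z * pairT (skew q x y) (kChar q).toLinearMap (Pol.comulHom q a) := by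
    intro x y z hz a
    induction a using Pol.induct with
    | hs z => rw [AlgHom.commutes]; simp [Algebra.TensorProduct.algebraMap_apply, ← map_one (algebraMap ℂ (Pol q)), skew_algebraMap, -map_one]
    | h1 => simp [Pol.comulHom]
    | h2 => simp [Pol.comulHom]
    | h3 =>
      simp [Pol.comulHom]
      rcases hz with ⟨rfl, rfl⟩ | ⟨rfl, rfl⟩
      · simp
      · rw [hq]; field_simp
    | h4 =>
      simp [Pol.comulHom]
      rcases hz with ⟨rfl, rfl⟩ | ⟨rfl, rfl⟩
      · rw [hq]; field_simp
      · simp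
    | hadd a b ha hb => simp only [map_add, ha, hb]; ring
    | hmul a b ha hb =>
      simp only [map_mul, pairT_mul (char_mul _) (skew_mul' x y),
        pairT_mul (skew_mul' x y) (char_mul _), ha, hb, kki, kik]
      simp
      ring
  have kis : ∀ (x y z : ℂ), (x = 0 ∧ z = qc q ∨ y = 0 ∧ z = (qc q)⁻¹) → ∀ a : Pol q,
      pairT (skew q x y) (kiChar q).toLinearMap (Pol.comulHom q a)
      = z * pairT (kiChar q).toLinearMap (skew q x y) (Pol.comulHom q a) := by
    intro x y z hz a
    induction a using Pol.induct with
    | hs z => rw [AlgHom.commutes]; simp [Algebra.TensorProduct.algebraMap_apply, ← map_one (algebraMap ℂ (Pol q)), skew_algebraMap, -map_one]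
    | h1 => simp [Pol.comulHom]
    | h2 => simp [Pol.comulHom]
    | h3 =>
      simp [Pol.comulHom]
      rcases hz with ⟨rfl, rfl⟩ | ⟨rfl, rfl⟩
      · simp
      · rw [hq]; field_simp
    | h4 =>
      simp [Pol.comulHom]
      rcases hz with ⟨rfl, rfl⟩ | ⟨rfl, rfl⟩
      · rw [hq]; field_simp
      · simp
    | hadd a b ha hb => simp only [map_add, ha, hb]; ring
    | hmul a b ha hb =>
      simp only [map_mul, pairT_mul (char_mul _) (skew_mul' x y),
        pairT_mul (skew_mul' x y) (char_mul _), ha, hb, kki, kik]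
      simp
      ring
  have he := ks 0 (-(qc q)⁻¹) (qc q) (Or.inl ⟨rfl, rfl⟩)
  have hf := ks 1 0 (qc q)⁻¹ (Or.inr ⟨rfl, rfl⟩)
  have hie := kis 0 (-(qc q)⁻¹) (qc q) (Or.inl ⟨rfl, rfl⟩)
  have hif := kis 1 0 (qc q)⁻¹ (Or.inr ⟨rfl, rfl⟩)
  refine ⟨?_, ?_, ?_, ?_, ?_⟩
  · ext a; exact kki a
  · ext a; exact kik a
  · ext a; exact he a
  · ext a; exact hf a
  · ext a
    rw [sq, sq]
    change pairT (skew q 0 (-(qc q)⁻¹)) (skew q 1 0) (Pol.comulHom q a)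
      - pairT (skew q 1 0) (skew q 0 (-(qc q)⁻¹)) (Pol.comulHom q a)
      = (qc q - (qc q)⁻¹)⁻¹ *
        (pairT (kChar q).toLinearMap (kChar q).toLinearMap (Pol.comulHom q a)
        - pairT (kiChar q).toLinearMap (kiChar q).toLinearMap (Pol.comulHom q a))
    induction a using Pol.induct with
    | hs z => rw [AlgHom.commutes]; simp [Algebra.TensorProduct.algebraMap_apply, skew_algebraMap]
    | h1 =>
      simp [Pol.comulHom, h0]
      rw [hi, qh_mul_qh, inv_mul_cancel₀ hd]
    | h2 =>
      simp [Pol.comulHom, h0]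
      rw [hi, qh_mul_qh, ← neg_sub (qc q), mul_neg, inv_mul_cancel₀ hd]
    | h3 => simp [Pol.comulHom]
    | h4 => simp [Pol.comulHom]
    | hadd a b ha hb => simp only [map_add]; linear_combination ha + hb
    | hmul a b ha hb =>
      simp only [map_mul, pairT_mul (char_mul _) (char_mul _), pairT_mul (skew_mul' _ _)
        (skew_mul' _ _), he, hf, hie, hif]
      simp only [pairT_zero_left, pairT_zero_right, LinearMap.zero_apply]
      linear_combination
        ha * pairT (kiChar q).toLinearMap (kiChar q).toLinearMap (Pol.comulHom q b)
        + pairT (kChar q).toLinearMap (kChar q).toLinearMap (Pol.comulHom q a) * hb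
        + (pairT (skew q 1 0) (kChar q).toLinearMap (Pol.comulHom q a)
            * pairT (kiChar q).toLinearMap (skew q 0 (-(qc q)⁻¹)) (Pol.comulHom q b)
          - pairT (skew q 0 (-(qc q)⁻¹)) (kChar q).toLinearMap (Pol.comulHom q a)
            * pairT (kiChar q).toLinearMap (skew q 1 0) (Pol.comulHom q b)) * hqq

/-- The pairing of `U_q(su_2)` with `𝒜`, as the homomorphism `U_q(su_2) → M(𝒜̂)`. -/
def pairing (q : Param) : Uq q →ₐ[ℂ] Dual q := Uq.lift (dual_sat q)

/-- `∂_ω(a) = (ι ⊗ ω)Δ(a)`, for a functional `ω`. -/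
def lact (ω : Dual q) : Pol q →ₗ[ℂ] Pol q :=
  (TensorProduct.rid ℂ (Pol q)).toLinearMap ∘ₗ LinearMap.lTensor (Pol q) ω.ofConv
    ∘ₗ Coalgebra.comul

/-- `a ◁ ω = (ω ⊗ ι)Δ(a)`, for a functional `ω`. -/
def ract (ω : Dual q) : Pol q →ₗ[ℂ] Pol q :=
  (TensorProduct.lid ℂ (Pol q)).toLinearMap ∘ₗ LinearMap.rTensor (Pol q) ω.ofConv
    ∘ₗ Coalgebra.comul

/-- The operator `∂_ω` on `𝒜`, for `ω ∈ U_q(su_2)`. -/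
def del (ω : Uq q) : Pol q →ₗ[ℂ] Pol q := lact (pairing q ω)

/-- The operator `a ↦ a ◁ Ŝ⁻¹(ω)` on `𝒜`, for `ω ∈ U_q(su_2)`. -/
def rho (ω : Uq q) : Pol q →ₗ[ℂ] Pol q := ract (pairing q (Uq.antipodeInv q ω).unop)

lemma lact_mul (φ ψ : Dual q) : lact (φ * ψ) = lact φ ∘ₗ lact ψ := by
  let G : Pol q ⊗[ℂ] (Pol q ⊗[ℂ] Pol q) →ₗ[ℂ] Pol q :=
    (TensorProduct.rid ℂ (Pol q)).toLinearMap ∘ₗ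
      LinearMap.lTensor (Pol q) (pairT φ.ofConv ψ.ofConv)
  have h1 : ∀ t : Pol q ⊗[ℂ] Pol q, TensorProduct.rid ℂ (Pol q)
      (LinearMap.lTensor (Pol q) (φ * ψ).ofConv t)
      = G (LinearMap.lTensor (Pol q) Coalgebra.comul t) := by
    intro t
    induction t with
    | zero => simp
    | add x y hx hy => simp only [map_add, hx, hy]
    | tmul a b => simp [G]; rfl
  have h2 : ∀ t : Pol q ⊗[ℂ] Pol q, lact φ (TensorProduct.rid ℂ (Pol q)
      (LinearMap.lTensor (Pol q) ψ.ofConv t))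
      = G (TensorProduct.assoc ℂ _ _ _ (LinearMap.rTensor (Pol q) Coalgebra.comul t)) := by
    intro t
    induction t with
    | zero => simp
    | add x y hx hy => simp only [map_add, hx, hy]
    | tmul a b =>
      simp only [LinearMap.lTensor_tmul, TensorProduct.rid_tmul, map_smul, LinearMap.rTensor_tmul]
      simp only [lact, LinearMap.comp_apply, LinearEquiv.coe_coe]
      generalize (Coalgebra.comul a : Pol q ⊗[ℂ] Pol q) = s
      induction s with
      | zero => simp
      | add x y hx hy => simp only [map_add, smul_add, hx, hy, TensorProduct.add_tmul]
      | tmul c d => simp [G, smul_smul, mul_comm]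
  ext a
  have := h2 (Coalgebra.comul a)
  rw [Coalgebra.coassoc_apply, ← h1] at this
  exact this.symm

lemma ract_lact (φ ψ : Dual q) (a : Pol q) : ract φ (lact ψ a) = lact ψ (ract φ a) := by
  let G : Pol q ⊗[ℂ] (Pol q ⊗[ℂ] Pol q) →ₗ[ℂ] Pol q :=
    (TensorProduct.lid ℂ (Pol q)).toLinearMap ∘ₗ
      TensorProduct.map φ.ofConv ((TensorProduct.rid ℂ (Pol q)).toLinearMap ∘ₗ
        LinearMap.lTensor (Pol q) ψ.ofConv)
  have h1 : ∀ t : Pol q ⊗[ℂ] Pol q, lact ψ (TensorProduct.lid ℂ (Pol q)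
      (LinearMap.rTensor (Pol q) φ.ofConv t))
      = G (LinearMap.lTensor (Pol q) Coalgebra.comul t) := by
    intro t
    induction t with
    | zero => simp
    | add x y hx hy => simp only [map_add, hx, hy]
    | tmul a b => simp [G]; rfl
  have h2 : ∀ t : Pol q ⊗[ℂ] Pol q, ract φ (TensorProduct.rid ℂ (Pol q)
      (LinearMap.lTensor (Pol q) ψ.ofConv t))
      = G (TensorProduct.assoc ℂ _ _ _ (LinearMap.rTensor (Pol q) Coalgebra.comul t)) := by
    intro t
    induction t with
    | zero => simp
    | add x y hx hy => simp only [map_add, hx, hy]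
    | tmul a b =>
      simp only [LinearMap.lTensor_tmul, TensorProduct.rid_tmul, map_smul, LinearMap.rTensor_tmul]
      simp only [ract, LinearMap.comp_apply, LinearEquiv.coe_coe]
      generalize (Coalgebra.comul a : Pol q ⊗[ℂ] Pol q) = s
      induction s with
      | zero => simp
      | add x y hx hy => simp only [map_add, smul_add, hx, hy, TensorProduct.add_tmul]
      | tmul c d => simp [G, smul_smul, mul_comm]
  have := h2 (Coalgebra.comul a)
  rw [Coalgebra.coassoc_apply, ← h1] at this
  exact this

lemma lact_char_mul (χ : Pol q →ₐ[ℂ] ℂ) (a b : Pol q) :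
    lact (WithConv.toConv χ.toLinearMap) (a * b) =
      lact (WithConv.toConv χ.toLinearMap) a * lact (WithConv.toConv χ.toLinearMap) b := by
  let F : Pol q →ₐ[ℂ] Pol q := (Algebra.TensorProduct.rid ℂ ℂ (Pol q)).toAlgHom.comp
    ((Algebra.TensorProduct.map (.id ℂ _) χ).comp (Pol.comulHom q))
  exact map_mul F a b

/-! ### The spectral subspaces `𝒜_n` -/

/-- `𝒜_n = {a ∈ 𝒜 | ∂_k(a) = q^{n/2} a}`; in particular `ℬ = 𝒜_0`. -/
def wt (q : Param) (n : ℤ) : Submodule ℂ (Pol q) :=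
  LinearMap.ker (del (Uq.k q) - (qh q ^ n) • LinearMap.id)

lemma mem_wt {n : ℤ} {a : Pol q} : a ∈ wt q n ↔ del (Uq.k q) a = qh q ^ n • a := by
  simp [wt, sub_eq_zero]

lemma del_mul (x y : Uq q) (a : Pol q) : del (x * y) a = del x (del y a) := by
  simp only [del, map_mul, lact_mul, LinearMap.comp_apply]

lemma lact_smul (c : ℂ) (φ : Dual q) : lact (c • φ) = c • lact φ := by
  ext a
  simp only [lact, LinearMap.comp_apply, WithConv.ofConv_smul, LinearMap.lTensor_smul,
    LinearMap.smul_apply, map_smul]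

lemma del_smul (c : ℂ) (x : Uq q) (a : Pol q) : del (c • x) a = c • del x a := by
  simp only [del, map_smul, lact_smul, LinearMap.smul_apply]

lemma del_k_mul (a b : Pol q) : del (Uq.k q) (a * b) = del (Uq.k q) a * del (Uq.k q) b := by
  have : pairing q (Uq.k q) = WithConv.toConv (kChar q).toLinearMap := Uq.lift_k _
  simp only [del, this]
  exact lact_char_mul _ _ _

lemma mul_mem_wt {m n p : ℤ} (hp : m + n = p) {a b : Pol q} (ha : a ∈ wt q m) (hb : b ∈ wt q n) :
    a * b ∈ wt q p := by
  rw [mem_wt] at *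
  rw [del_k_mul, ha, hb, ← hp, zpow_add₀ (qh_ne_zero q), smul_mul_smul_comm]

/-- `∂_e(𝒜_n) ⊆ 𝒜_{n+2}`. -/
lemma del_e_mem_wt {n p : ℤ} (hp : n + 2 = p) {a : Pol q} (ha : a ∈ wt q n) :
    del (Uq.e q) a ∈ wt q p := by
  rw [mem_wt] at *
  rw [← del_mul, (Uq.sat q).rel3, del_smul, del_mul, ha, map_smul, smul_smul, ← hp,
    zpow_add₀ (qh_ne_zero q), ← qh_mul_qh]
  congr 1
  rw [zpow_two, mul_comm]

/-- `∂_f(𝒜_n) ⊆ 𝒜_{n-2}`. -/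
lemma del_f_mem_wt {n p : ℤ} (hp : n - 2 = p) {a : Pol q} (ha : a ∈ wt q n) :
    del (Uq.f q) a ∈ wt q p := by
  rw [mem_wt] at *
  rw [← del_mul, (Uq.sat q).rel4, del_smul, del_mul, ha, map_smul, smul_smul, ← hp,
    zpow_sub₀ (qh_ne_zero q), ← qh_mul_qh]
  congr 1
  rw [zpow_two, mul_comm, div_eq_mul_inv]

/-- The second representation of `U_q(su_2)` preserves `𝒜_n`. -/
lemma rho_mem_wt (ω : Uq q) {n : ℤ} {a : Pol q} (ha : a ∈ wt q n) : rho ω a ∈ wt q n := by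
  rw [mem_wt] at *
  rw [rho, del, ← ract_lact]
  change ract _ (del (Uq.k q) a) = _
  rw [ha, map_smul]

/-! ### The Haar state and the Hilbert space `L²(A, h)` -/

/-- The Haar state of `SU_q(2)`: the unital positive linear functional on `𝒜` which is left and right
invariant, `(ι ⊗ h)Δ(a) = h(a)1 = (h ⊗ ι)Δ(a)`. -/
structure HaarState (q : Param) where
  /-- the functional -/
  fn : Pol q →ₗ[ℂ] ℂ
  map_one : fn 1 = 1
  nonneg : ∀ a : Pol q, 0 ≤ fn (star a * a)
  inv_right : ∀ a : Pol q, TensorProduct.rid ℂ (Pol q)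
    (LinearMap.lTensor (Pol q) fn (Coalgebra.comul a)) = fn a • (1 : Pol q)
  inv_left : ∀ a : Pol q, TensorProduct.lid ℂ (Pol q)
    (LinearMap.rTensor (Pol q) fn (Coalgebra.comul a)) = fn a • (1 : Pol q)

/-- The Haar state is unique. -/
lemma HaarState.fn_eq (h h' : HaarState q) : h.fn = h'.fn := by
  ext a
  have h1 := h.inv_right a
  have h2 := h'.inv_left a
  have e : ∀ t : Pol q ⊗[ℂ] Pol q, h'.fn (TensorProduct.rid ℂ (Pol q)
    (LinearMap.lTensor (Pol q) h.fn t)) = h.fn (TensorProduct.lid ℂ (Pol q)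
    (LinearMap.rTensor (Pol q) h'.fn t)) := by
    intro t
    induction t with
    | zero => simp
    | add x y hx hy => simp only [map_add, hx, hy]
    | tmul a b => simp [mul_comm]
  have := e (Coalgebra.comul a)
  rw [h1, h2] at this
  simpa [h.map_one, h'.map_one] using this

lemma HaarState.map_star (h : HaarState q) (x : Pol q) :
    h.fn (star x) = (starRingEnd ℂ) (h.fn x) := by
  have h0 := (Complex.nonneg_iff.1 (h.nonneg x)).2
  have h1 := (Complex.nonneg_iff.1 (h.nonneg (x + 1))).2
  have h2 := (Complex.nonneg_iff.1 (h.nonneg (Complex.I • x + 1))).2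
  simp [mul_add, add_mul, h.map_one] at h1 h2 h0
  apply Complex.ext
  · simp; linarith
  · simp; linarith

set_option linter.unusedVariables false in
/-- The algebra `𝒜` with the semi-inner product `⟨a, b⟩ = h(a* b)`. -/
def PreL2 (h : HaarState q) : Type := Pol q

instance (h : HaarState q) : AddCommGroup (PreL2 h) := inferInstanceAs (AddCommGroup (Pol q))
instance (h : HaarState q) : Module ℂ (PreL2 h) := inferInstanceAs (Module ℂ (Pol q))

/-- The identity map from `𝒜` to `PreL2 h`. -/
def toPre (h : HaarState q) : Pol q ≃ₗ[ℂ] PreL2 h := LinearEquiv.refl ℂ _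

/-- The semi-inner product `⟨a, b⟩ = h(a* b)`. -/
abbrev preL2Core (h : HaarState q) : PreInnerProductSpace.Core ℂ (PreL2 h) where
  inner a b := h.fn (star ((toPre h).symm a) * (toPre h).symm b)
  conj_inner_symm a b := by rw [← h.map_star]; simp
  re_inner_nonneg a := (Complex.nonneg_iff.1 (h.nonneg _)).1
  add_left a b c := by simp [add_mul]
  smul_left a b z := by simp

instance (h : HaarState q) : SeminormedAddCommGroup (PreL2 h) :=
  InnerProductSpace.Core.toSeminormedAddCommGroup (c := preL2Core h)
instance (h : HaarState q) : InnerProductSpace ℂ (PreL2 h) :=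
  InnerProductSpace.ofCore (preL2Core h)

lemma preL2_norm_sq (h : HaarState q) (a : Pol q) :
    ‖toPre h a‖ ^ 2 = (h.fn (star a * a)).re := by
  rw [@norm_sq_eq_re_inner ℂ]; rfl

/-- The Hilbert space `L²(A, h)`: the completion of `𝒜` with respect to `⟨a, b⟩ = h(a* b)`. -/
abbrev L2 (h : HaarState q) : Type := UniformSpace.Completion (PreL2 h)

/-- The canonical map `a ↦ a ξ_h` from `𝒜` to `L²(A, h)`. -/
def toL2 (h : HaarState q) : Pol q →ₗ[ℂ] L2 h :=
  (UniformSpace.Completion.toComplL (𝕜 := ℂ) (E := PreL2 h)).toLinearMap ∘ₗ (toPre h).toLinearMap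

/-- Left multiplication by `a` on `PreL2 h`. -/
def preMul (h : HaarState q) (a : Pol q) : PreL2 h →ₗ[ℂ] PreL2 h :=
  (toPre h).toLinearMap ∘ₗ LinearMap.mulLeft ℂ a ∘ₗ (toPre h).symm.toLinearMap

lemma preMul_bound (h : HaarState q) (a : Pol q) :
    ∃ C : ℝ, ∀ x : PreL2 h, ‖preMul h a x‖ ≤ C * ‖x‖ := by
  suffices H : ∃ C : ℝ, 0 ≤ C ∧ ∀ x : Pol q, ‖toPre h (a * x)‖ ≤ C * ‖toPre h x‖ by
    obtain ⟨C, -, hC⟩ := H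
    exact ⟨C, fun x => hC ((toPre h).symm x)⟩
  have hsat := Pol.sat q
  have e1 : ∀ x : Pol q, ‖toPre h (Pol.al q * x)‖ ^ 2 + ‖toPre h (Pol.ga q * x)‖ ^ 2
      = ‖toPre h x‖ ^ 2 := by
    intro x
    simp only [preL2_norm_sq, ← Complex.add_re, ← map_add, star_mul, Pol.star_al, Pol.star_ga]
    congr 2
    calc _ = star x * (Pol.als q * Pol.al q + Pol.gas q * Pol.ga q) * x := by noncomm_ring
      _ = _ := by rw [hsat.rel1, mul_one]
  have e2 : ∀ x : Pol q, ‖toPre h (Pol.als q * x)‖ ^ 2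
      + (q : ℝ) ^ 2 * ‖toPre h (Pol.ga q * x)‖ ^ 2 = ‖toPre h x‖ ^ 2 := by
    intro x
    have : ∀ y : Pol q, (q : ℝ) ^ 2 * (h.fn y).re = (h.fn (qc q ^ 2 • y)).re := by
      intro y
      rw [map_smul, smul_eq_mul, qc, ← Complex.ofReal_pow, Complex.re_ofReal_mul]
    simp only [preL2_norm_sq, this, ← Complex.add_re, ← map_add,
      star_mul, Pol.star_als, Pol.star_ga]
    congr 2
    calc _ = star x * (Pol.al q * Pol.als q + qc q ^ 2 • (Pol.gas q * Pol.ga q)) * x := by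
          simp only [mul_add, add_mul, mul_smul_comm, smul_mul_assoc, mul_assoc]
      _ = _ := by rw [hsat.rel2, mul_one]
  have e3 : ∀ x : Pol q, ‖toPre h (Pol.gas q * x)‖ ^ 2 = ‖toPre h (Pol.ga q * x)‖ ^ 2 := by
    intro x
    simp only [preL2_norm_sq, star_mul, Pol.star_gas, Pol.star_ga]
    congr 2
    calc _ = star x * (Pol.ga q * Pol.gas q) * x := by noncomm_ring
      _ = _ := by rw [← hsat.rel3]; noncomm_ring
  have sqle : ∀ {s t : ℝ}, 0 ≤ t → s ^ 2 ≤ t ^ 2 → s ≤ 1 * t := fun ht hst => by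
    rw [one_mul]; exact le_of_sq_le_sq hst ht
  induction a using Pol.induct with
  | hs z =>
    refine ⟨‖z‖, norm_nonneg _, fun x => ?_⟩
    rw [← Algebra.smul_def, map_smul, norm_smul]
  | h1 => exact ⟨1, zero_le_one, fun x => sqle (norm_nonneg _) (by nlinarith [e1 x])⟩
  | h2 => exact ⟨1, zero_le_one, fun x => sqle (norm_nonneg _) (by
      have := e2 x; have : 0 ≤ (q : ℝ) ^ 2 * ‖toPre h (Pol.ga q * x)‖ ^ 2 := by positivity
      linarith)⟩
  | h3 => exact ⟨1, zero_le_one, fun x => sqle (norm_nonneg _) (by nlinarith [e1 x])⟩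
  | h4 => exact ⟨1, zero_le_one, fun x => sqle (norm_nonneg _) (by
      rw [e3]; nlinarith [e1 x])⟩
  | hadd a b ha hb =>
    obtain ⟨C, hC0, hC⟩ := ha
    obtain ⟨C', hC0', hC'⟩ := hb
    refine ⟨C + C', add_nonneg hC0 hC0', fun x => ?_⟩
    rw [add_mul, map_add, add_mul]
    exact (norm_add_le _ _).trans (add_le_add (hC x) (hC' x))
  | hmul a b ha hb =>
    obtain ⟨C, hC0, hC⟩ := ha
    obtain ⟨C', hC0', hC'⟩ := hb
    refine ⟨C * C', mul_nonneg hC0 hC0', fun x => ?_⟩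
    rw [mul_assoc, mul_assoc]
    exact (hC _).trans (mul_le_mul_of_nonneg_left (hC' x) hC0)

/-- The bounded operator of left multiplication by `a` on `L²(A, h)`. -/
def leftMul (h : HaarState q) (a : Pol q) : L2 h →L[ℂ] L2 h :=
  ContinuousLinearMap.completion
    (LinearMap.mkContinuousOfExistsBound (preMul h a) (preMul_bound h a))

lemma leftMul_toL2 (h : HaarState q) (a x : Pol q) : leftMul h a (toL2 h x) = toL2 h (a * x) := by
  simp [leftMul, toL2]
  rfl

/-- `L²(A_n, h)`: the closure of `𝒜_n` in `L²(A, h)`. -/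
def L2w (h : HaarState q) (n : ℤ) : Submodule ℂ (L2 h) :=
  ((wt q n).map (toL2 h)).topologicalClosure

lemma toL2_mem (h : HaarState q) {n : ℤ} {a : Pol q} (ha : a ∈ wt q n) : toL2 h a ∈ L2w h n :=
  Submodule.le_topologicalClosure _ (Submodule.mem_map_of_mem ha)

lemma leftMul_mem (h : HaarState q) {m n p : ℤ} (hp : m + n = p) {a : Pol q} (ha : a ∈ wt q m)
    {x : L2 h} (hx : x ∈ L2w h n) : leftMul h a x ∈ L2w h p := by
  refine map_mem_closure (leftMul h a).continuous hx ?_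
  rintro _ ⟨b, hb, rfl⟩
  rw [leftMul_toL2]
  exact ⟨a * b, mul_mem_wt hp ha hb, rfl⟩

/-- The canonical map `𝒜_n → L²(A_n, h)`. -/
def toL2w (h : HaarState q) (n : ℤ) : wt q n →ₗ[ℂ] L2w h n :=
  (toL2 h).restrict fun _ ha => toL2_mem h ha

/-- Left multiplication by `a ∈ 𝒜_m` as a bounded operator `L²(A_n, h) → L²(A_p, h)`, where
`p = m + n`. -/
def mulOp (h : HaarState q) {m n p : ℤ} (hp : m + n = p) (a : wt q m) :
    L2w h n →L[ℂ] L2w h p :=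
  ((leftMul h a).comp (L2w h n).subtypeL).codRestrict (L2w h p)
    fun x => leftMul_mem h hp a.2 x.2

/-! ### Spinors and the Dirac operator -/

/-- The Hilbert space of `L²`-spinors `H₊ ⊕ H₋ = L²(A_1, h) ⊕ L²(A_{-1}, h)`. -/
abbrev Spinor (h : HaarState q) : Type := WithLp 2 (L2w h 1 × L2w h (-1))

/-- The space of polynomial spinors `𝒜_1 ⊕ 𝒜_{-1}`. -/
abbrev PolSpinor (q : Param) : Type := wt q 1 × wt q (-1)

/-- The canonical map `𝒜_1 ⊕ 𝒜_{-1} → H₊ ⊕ H₋`, with dense range. -/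
def toSpinor (h : HaarState q) : PolSpinor q →ₗ[ℂ] Spinor h :=
  (WithLp.linearEquiv 2 ℂ (L2w h 1 × L2w h (-1))).symm.toLinearMap ∘ₗ
    (toL2w h 1).prodMap (toL2w h (-1))

/-- The matrix `(0, ∂_e; ∂_f, 0)` on `𝒜_1 ⊕ 𝒜_{-1}`. -/
def diracPol (q : Param) : PolSpinor q →ₗ[ℂ] PolSpinor q :=
  LinearMap.prod
    ((del (Uq.e q)).restrict (p := wt q (-1)) (q := wt q 1)
      (fun _ ha => del_e_mem_wt (by norm_num) ha) ∘ₗ LinearMap.snd ℂ _ _)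
    ((del (Uq.f q)).restrict (p := wt q 1) (q := wt q (-1))
      (fun _ ha => del_f_mem_wt (by norm_num) ha) ∘ₗ LinearMap.fst ℂ _ _)

/-- The second representation `ω ↦ (a ↦ a ◁ Ŝ⁻¹(ω))` of `U_q(su_2)` on `𝒜_1 ⊕ 𝒜_{-1}`. -/
def rhoPol (ω : Uq q) : PolSpinor q →ₗ[ℂ] PolSpinor q :=
  LinearMap.prodMap
    ((rho ω).restrict (p := wt q 1) (q := wt q 1) (fun _ ha => rho_mem_wt ω ha))
    ((rho ω).restrict (p := wt q (-1)) (q := wt q (-1)) (fun _ ha => rho_mem_wt ω ha))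

/-- The closure in `(H₊ ⊕ H₋) × (H₊ ⊕ H₋)` of the graph of an operator given on polynomial
spinors. -/
def closedGraph (h : HaarState q) (T : PolSpinor q →ₗ[ℂ] PolSpinor q) :
    Submodule ℂ (Spinor h × Spinor h) :=
  (LinearMap.range ((toSpinor h).prod (toSpinor h ∘ₗ T))).topologicalClosure

/-- The closure of an operator given on polynomial spinors, as an unbounded operator on
`H₊ ⊕ H₋`. (It is meaningful if `closedGraph h T` is the graph of an operator, that is, if
`(closedOp h T).graph = closedGraph h T`.) -/
def closedOp (h : HaarState q) (T : PolSpinor q →ₗ[ℂ] PolSpinor q) : Spinor h →ₗ.[ℂ] Spinor h :=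
  (closedGraph h T).toLinearPMap

/-- The Dirac operator `D = (0, ∂_e; ∂_f, 0)` on `H₊ ⊕ H₋`. -/
def dirac (h : HaarState q) : Spinor h →ₗ.[ℂ] Spinor h := closedOp h (diracPol q)

/-- The Casimir `C` of `U_q(su_2)` as an operator on `H₊ ⊕ H₋`. -/
def casimirOp (h : HaarState q) : Spinor h →ₗ.[ℂ] Spinor h := closedOp h (rhoPol (Uq.casimir q))

/-- The product `S T` of unbounded operators, on `{ξ ∈ dom T | T ξ ∈ dom S}`. -/
def pmapMul {E : Type*} [AddCommGroup E] [Module ℂ E] (S T : E →ₗ.[ℂ] E) : E →ₗ.[ℂ] E where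
  domain := (S.domain.comap T.toFun).map T.domain.subtype
  toFun := S.toFun ∘ₗ
    (T.toFun.restrict (p := S.domain.comap T.toFun) (q := S.domain) fun _ hx => hx) ∘ₗ
    (Submodule.equivMapOfInjective T.domain.subtype T.domain.subtype_injective
      (S.domain.comap T.toFun)).symm.toLinearMap

lemma mem_pmapMul_domain {E : Type*} [AddCommGroup E] [Module ℂ E] (S T : E →ₗ.[ℂ] E) (x : E) :
    x ∈ (pmapMul S T).domain ↔ ∃ hx : x ∈ T.domain, T ⟨x, hx⟩ ∈ S.domain := by
  constructor
  · rintro ⟨y, hy, rfl⟩; exact ⟨y.2, hy⟩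
  · rintro ⟨hx, hy⟩; exact ⟨⟨x, hx⟩, hy, rfl⟩

lemma pmapMul_apply {E : Type*} [AddCommGroup E] [Module ℂ E] (S T : E →ₗ.[ℂ] E) (x : E)
    (hx : x ∈ T.domain) (hy : T ⟨x, hx⟩ ∈ S.domain) (hxy : x ∈ (pmapMul S T).domain) :
    pmapMul S T ⟨x, hxy⟩ = S ⟨T ⟨x, hx⟩, hy⟩ := by
  have : (Submodule.equivMapOfInjective T.domain.subtype T.domain.subtype_injective
      (S.domain.comap T.toFun)).symm ⟨x, hxy⟩ = ⟨⟨x, hx⟩, hy⟩ := by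
    rw [LinearEquiv.symm_apply_eq]; rfl
  change S.toFun ((T.toFun.restrict (p := S.domain.comap T.toFun) (q := S.domain) fun _ hx => hx)
    ((Submodule.equivMapOfInjective T.domain.subtype T.domain.subtype_injective
      (S.domain.comap T.toFun)).symm ⟨x, hxy⟩)) = _
  rw [this]; rfl

/-- The bounded operator on `H₊ ⊕ H₋` with matrix `(a, b; c, d)`. -/
def blockOp {h : HaarState q} (a : L2w h 1 →L[ℂ] L2w h 1) (b : L2w h (-1) →L[ℂ] L2w h 1)
    (c : L2w h 1 →L[ℂ] L2w h (-1)) (d : L2w h (-1) →L[ℂ] L2w h (-1)) : Spinor h →L[ℂ] Spinor h :=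
  (WithLp.prodContinuousLinearEquiv 2 ℂ (L2w h 1) (L2w h (-1))).symm.toContinuousLinearMap ∘L
    ((a.coprod b).prod (c.coprod d)) ∘L
    (WithLp.prodContinuousLinearEquiv 2 ℂ (L2w h 1) (L2w h (-1))).toContinuousLinearMap

/-- The action of `b ∈ ℬ` on `H₊ ⊕ H₋` by left multiplication. -/
def mulSpinor (h : HaarState q) (b : wt q 0) : Spinor h →L[ℂ] Spinor h :=
  blockOp (mulOp h (zero_add 1) b) 0 0 (mulOp h (zero_add (-1)) b)

/-- `∂_e(b) ∈ 𝒜_2` for `b ∈ ℬ`. -/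
def delE (b : wt q 0) : wt q 2 := ⟨del (Uq.e q) b, del_e_mem_wt (by norm_num) b.2⟩

/-- `∂_f(b) ∈ 𝒜_{-2}` for `b ∈ ℬ`. -/
def delF (b : wt q 0) : wt q (-2) := ⟨del (Uq.f q) b, del_f_mem_wt (by norm_num) b.2⟩

end SUq

end

noncomputable section

namespace SUq

open scoped TensorProduct ComplexOrder

variable {q : Param}

/-! ### Leibniz rules -/

/-! The proof separates algebra on polynomial spinors from one general fact about closures.

Symmetry. Invariance of the Haar state gives `h(∂_ω a) = ω(1) h(a)`. Applied to `∂_f(a* b)`, with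
the twisted Leibniz rule and `∂_f(a*) = -q ∂_e(a)*`, it shows that `∂_e` and `∂_f` are formal
adjoints (`fn_star_del_e_mul`). Hence the polynomial Dirac operator is symmetric (`inner_diracPol`)
and therefore closable.

Casimir. Up to scaling and an additive constant, `C` is the quantum trace of `M = L N`, with `L =
(k, c f; 0, k⁻¹)` and `N = (k, 0; c e, k⁻¹)`. The fundamental corepresentation intertwines the left
and right actions of `L` and of `N` (`triRdel_f_mul_fundRep`, `triDel_e_mul_fundRep`), so the
quantum trace acts identically from both sides (`rdel_qTrace`). Since also `Ŝ⁻¹(C) = C`, the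
operator `a ↦ a ◁ Ŝ⁻¹(C)` is `∂_C`. On `𝒜_{-1}` the Cartan part of `C` vanishes, leaving `∂_f ∂_e`;
on `𝒜_1` it equals `1 = ef - fe`, leaving `∂_e ∂_f`. So the square of the polynomial Dirac operator
is the Casimir operator (`rhoPol_casimir`).

Closures. For a symmetric operator `T` on a dense core, `‖(T² + 1)a‖` controls `‖a‖` and `‖Ta‖`. If
every vector of the core lies in a finite-dimensional invariant subspace, `T² + 1` also has dense
range. Together these force the closure of `T²` to be the square of the closure of `T`
(`mem_graphClosure_sq`). Local finiteness holds because `Δ(a)` is a finite sum of elementary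
tensors.

Commutator. On polynomial spinors the formula is the twisted Leibniz rule with weights inserted. The
operators `b` and `[D, b]` are bounded, so it extends to the closed graph (`mulSpinor_mem_graph`).
-/

lemma lact_apply (φ : Dual q) (a : Pol q) : lact φ a =
    TensorProduct.rid ℂ (Pol q) (LinearMap.lTensor (Pol q) φ.ofConv (Pol.comulHom q a)) := rfl

lemma ract_apply (φ : Dual q) (a : Pol q) : ract φ a =
    TensorProduct.lid ℂ (Pol q) (LinearMap.rTensor (Pol q) φ.ofConv (Pol.comulHom q a)) := rfl

lemma lact_leibniz {φ φ₁ φ₁' φ₂ φ₂' : Dual q}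
    (hφ : ∀ a b, φ.ofConv (a * b) = φ₁.ofConv a * φ₁'.ofConv b + φ₂.ofConv a * φ₂'.ofConv b)
    (a b : Pol q) : lact φ (a * b) = lact φ₁ a * lact φ₁' b + lact φ₂ a * lact φ₂' b := by
  simp only [lact_apply, map_mul]
  generalize Pol.comulHom q a = x
  generalize Pol.comulHom q b = y
  induction x with
  | zero => simp
  | add x x' hx hx' => simp only [add_mul, map_add, hx, hx']; abel
  | tmul a b =>
    induction y with
    | zero => simp
    | add y y' hy hy' => simp only [mul_add, map_add, hy, hy']; abel
    | tmul c d =>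
      simp only [Algebra.TensorProduct.tmul_mul_tmul, LinearMap.lTensor_tmul,
        TensorProduct.rid_tmul, hφ, smul_mul_smul_comm, add_smul]

lemma ract_leibniz {φ φ₁ φ₁' φ₂ φ₂' : Dual q}
    (hφ : ∀ a b, φ.ofConv (a * b) = φ₁.ofConv a * φ₁'.ofConv b + φ₂.ofConv a * φ₂'.ofConv b)
    (a b : Pol q) : ract φ (a * b) = ract φ₁ a * ract φ₁' b + ract φ₂ a * ract φ₂' b := by
  simp only [ract_apply, map_mul]
  generalize Pol.comulHom q a = x
  generalize Pol.comulHom q b = y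
  induction x with
  | zero => simp
  | add x x' hx hx' => simp only [add_mul, map_add, hx, hx']; abel
  | tmul a b =>
    induction y with
    | zero => simp
    | add y y' hy hy' => simp only [mul_add, map_add, hy, hy']; abel
    | tmul c d =>
      simp only [Algebra.TensorProduct.tmul_mul_tmul, LinearMap.rTensor_tmul,
        TensorProduct.lid_tmul, hφ, smul_mul_smul_comm, add_smul]

lemma ofConv_ract (φ ψ : Dual q) (a : Pol q) : ψ.ofConv (ract φ a) = (φ * ψ).ofConv a := by
  change _ = pairT φ.ofConv ψ.ofConv (Pol.comulHom q a)
  rw [ract_apply]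
  generalize Pol.comulHom q a = x
  induction x with
  | zero => simp
  | add x x' hx hx' => simp only [map_add, hx, hx']
  | tmul a b => simp

/-- Linear functionals separate points of `𝒜`, and tested against them the claim becomes
associativity of convolution. The order is reversed because this is a right action. -/
lemma ract_mul (φ ψ : Dual q) (a : Pol q) : ract (φ * ψ) a = ract ψ (ract φ a) := by
  rw [← sub_eq_zero, ← Module.forall_dual_apply_eq_zero_iff ℂ]
  intro ω
  have := ofConv_ract (φ * ψ) (WithConv.toConv ω) a
  have h2 := (ofConv_ract ψ (WithConv.toConv ω) (ract φ a)).trans (ofConv_ract φ _ a)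
  rw [← mul_assoc] at h2
  simpa [sub_eq_zero] using this.trans h2.symm

/-- The operator `a ↦ a ◁ ω` on `𝒜`, for `ω ∈ U_q(su_2)`. -/
def rdel (ω : Uq q) : Pol q →ₗ[ℂ] Pol q := ract (pairing q ω)

lemma rdel_mul (x y : Uq q) (a : Pol q) : rdel (x * y) a = rdel y (rdel x a) := by
  simp only [rdel, map_mul, ract_mul]

lemma lact_add (φ ψ : Dual q) : lact (φ + ψ) = lact φ + lact ψ := by
  ext a
  simp only [lact_apply, WithConv.ofConv_add, LinearMap.lTensor_add,
    LinearMap.add_apply, map_add]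

lemma ract_add (φ ψ : Dual q) : ract (φ + ψ) = ract φ + ract ψ := by
  ext a
  simp only [ract_apply, WithConv.ofConv_add, LinearMap.rTensor_add,
    LinearMap.add_apply, map_add]

lemma ract_smul (c : ℂ) (φ : Dual q) : ract (c • φ) = c • ract φ := by
  ext a
  simp only [ract_apply, WithConv.ofConv_smul, LinearMap.rTensor_smul,
    LinearMap.smul_apply, map_smul]

lemma del_add (x y : Uq q) (a : Pol q) : del (x + y) a = del x a + del y a := by
  simp only [del, map_add, lact_add, LinearMap.add_apply]

lemma rdel_add (x y : Uq q) (a : Pol q) : rdel (x + y) a = rdel x a + rdel y a := by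
  simp only [rdel, map_add, ract_add, LinearMap.add_apply]

lemma rdel_smul (c : ℂ) (x : Uq q) (a : Pol q) : rdel (c • x) a = c • rdel x a := by
  simp only [rdel, map_smul, ract_smul, LinearMap.smul_apply]

lemma del_one (a : Pol q) : del (1 : Uq q) a = a := by
  have : pairing q (1 : Uq q) = WithConv.toConv (Coalgebra.counit : Pol q →ₗ[ℂ] ℂ) := by
    rw [map_one]; rfl
  rw [del, this, lact]
  simp

lemma rdel_one (a : Pol q) : rdel (1 : Uq q) a = a := by
  have : pairing q (1 : Uq q) = WithConv.toConv (Coalgebra.counit : Pol q →ₗ[ℂ] ℂ) := by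
    rw [map_one]; rfl
  rw [rdel, this, ract]
  simp

lemma del_sub (x y : Uq q) (a : Pol q) : del (x - y) a = del x a - del y a := by
  rw [eq_sub_iff_add_eq, ← del_add, sub_add_cancel]

lemma rdel_sub (x y : Uq q) (a : Pol q) : rdel (x - y) a = rdel x a - rdel y a := by
  rw [eq_sub_iff_add_eq, ← rdel_add, sub_add_cancel]

lemma del_rdel (x y : Uq q) (a : Pol q) : del x (rdel y a) = rdel y (del x a) :=
  (ract_lact _ _ _).symm

lemma pairing_e : pairing q (Uq.e q) = eDual q := Uq.lift_e _
lemma pairing_f : pairing q (Uq.f q) = fDual q := Uq.lift_f _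
lemma pairing_k : pairing q (Uq.k q) = kDual q := Uq.lift_k _
lemma pairing_ki : pairing q (Uq.ki q) = kiDual q := Uq.lift_ki _

lemma eDual_mul (a b : Pol q) : (eDual q).ofConv (a * b) =
    (eDual q).ofConv a * (kiDual q).ofConv b + (kDual q).ofConv a * (eDual q).ofConv b :=
  skew_mul' _ _ a b
lemma fDual_mul (a b : Pol q) : (fDual q).ofConv (a * b) =
    (fDual q).ofConv a * (kiDual q).ofConv b + (kDual q).ofConv a * (fDual q).ofConv b :=
  skew_mul' _ _ a b
lemma kDual_mul (a b : Pol q) : (kDual q).ofConv (a * b) =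
    (kDual q).ofConv a * (kDual q).ofConv b +
      (0 : Dual q).ofConv a * (0 : Dual q).ofConv b :=
  char_mul _ a b
lemma kiDual_mul (a b : Pol q) : (kiDual q).ofConv (a * b) =
    (kiDual q).ofConv a * (kiDual q).ofConv b +
      (0 : Dual q).ofConv a * (0 : Dual q).ofConv b :=
  char_mul _ a b

lemma lact_zero : lact (0 : Dual q) = 0 := by
  simpa using lact_smul (0 : ℂ) (0 : Dual q)
lemma ract_zero : ract (0 : Dual q) = 0 := by
  simpa using ract_smul (0 : ℂ) (0 : Dual q)

lemma del_e_mul (a b : Pol q) : del (Uq.e q) (a * b) =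
    del (Uq.e q) a * del (Uq.ki q) b + del (Uq.k q) a * del (Uq.e q) b := by
  simp only [del, pairing_e, pairing_k, pairing_ki]; exact lact_leibniz eDual_mul a b
lemma del_f_mul (a b : Pol q) : del (Uq.f q) (a * b) =
    del (Uq.f q) a * del (Uq.ki q) b + del (Uq.k q) a * del (Uq.f q) b := by
  simp only [del, pairing_f, pairing_k, pairing_ki]; exact lact_leibniz fDual_mul a b
lemma del_ki_mul (a b : Pol q) : del (Uq.ki q) (a * b) =
    del (Uq.ki q) a * del (Uq.ki q) b := by
  simp only [del, pairing_ki]; simpa [lact_zero] using lact_leibniz kiDual_mul a b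
lemma rdel_e_mul (a b : Pol q) : rdel (Uq.e q) (a * b) =
    rdel (Uq.e q) a * rdel (Uq.ki q) b + rdel (Uq.k q) a * rdel (Uq.e q) b := by
  simp only [rdel, pairing_e, pairing_k, pairing_ki]; exact ract_leibniz eDual_mul a b
lemma rdel_f_mul (a b : Pol q) : rdel (Uq.f q) (a * b) =
    rdel (Uq.f q) a * rdel (Uq.ki q) b + rdel (Uq.k q) a * rdel (Uq.f q) b := by
  simp only [rdel, pairing_f, pairing_k, pairing_ki]; exact ract_leibniz fDual_mul a b
lemma rdel_k_mul (a b : Pol q) : rdel (Uq.k q) (a * b) =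
    rdel (Uq.k q) a * rdel (Uq.k q) b := by
  simp only [rdel, pairing_k]; simpa [ract_zero] using ract_leibniz kDual_mul a b
lemma rdel_ki_mul (a b : Pol q) : rdel (Uq.ki q) (a * b) =
    rdel (Uq.ki q) a * rdel (Uq.ki q) b := by
  simp only [rdel, pairing_ki]; simpa [ract_zero] using ract_leibniz kiDual_mul a b

/-! ### Values on the generators -/

section generators

variable (ω : Uq q)

lemma del_algebraMap (z : ℂ) : del ω (algebraMap ℂ (Pol q) z) =
    (pairing q ω).ofConv 1 • algebraMap ℂ (Pol q) z := by
  simp [del, lact_apply, Algebra.algebraMap_eq_smul_one, Algebra.TensorProduct.one_def,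
    smul_smul, mul_comm]

lemma rdel_algebraMap (z : ℂ) : rdel ω (algebraMap ℂ (Pol q) z) =
    (pairing q ω).ofConv 1 • algebraMap ℂ (Pol q) z := by
  simp [rdel, ract_apply, Algebra.algebraMap_eq_smul_one, Algebra.TensorProduct.one_def,
    smul_smul, mul_comm]

lemma del_al : del ω (Pol.al q) = (pairing q ω).ofConv (Pol.al q) • Pol.al q -
    (qc q * (pairing q ω).ofConv (Pol.ga q)) • Pol.gas q := by
  simp [del, lact_apply, Pol.comulHom, smul_smul]
lemma del_als : del ω (Pol.als q) = (pairing q ω).ofConv (Pol.als q) • Pol.als q -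
    (qc q * (pairing q ω).ofConv (Pol.gas q)) • Pol.ga q := by
  simp [del, lact_apply, Pol.comulHom, smul_smul]
lemma del_ga : del ω (Pol.ga q) = (pairing q ω).ofConv (Pol.al q) • Pol.ga q +
    (pairing q ω).ofConv (Pol.ga q) • Pol.als q := by
  simp [del, lact_apply, Pol.comulHom]
lemma del_gas : del ω (Pol.gas q) = (pairing q ω).ofConv (Pol.als q) • Pol.gas q +
    (pairing q ω).ofConv (Pol.gas q) • Pol.al q := by
  simp [del, lact_apply, Pol.comulHom]

lemma rdel_al : rdel ω (Pol.al q) = (pairing q ω).ofConv (Pol.al q) • Pol.al q -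
    (qc q * (pairing q ω).ofConv (Pol.gas q)) • Pol.ga q := by
  simp [rdel, ract_apply, Pol.comulHom, smul_smul]
lemma rdel_als : rdel ω (Pol.als q) = (pairing q ω).ofConv (Pol.als q) • Pol.als q -
    (qc q * (pairing q ω).ofConv (Pol.ga q)) • Pol.gas q := by
  simp [rdel, ract_apply, Pol.comulHom, smul_smul]
lemma rdel_ga : rdel ω (Pol.ga q) = (pairing q ω).ofConv (Pol.ga q) • Pol.al q +
    (pairing q ω).ofConv (Pol.als q) • Pol.ga q := by
  simp [rdel, ract_apply, Pol.comulHom]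
lemma rdel_gas : rdel ω (Pol.gas q) = (pairing q ω).ofConv (Pol.gas q) • Pol.als q +
    (pairing q ω).ofConv (Pol.al q) • Pol.gas q := by
  simp [rdel, ract_apply, Pol.comulHom]

end generators

lemma eDual_apply (a : Pol q) : (eDual q).ofConv a = skew q 0 (-(qc q)⁻¹) a := rfl
lemma fDual_apply (a : Pol q) : (fDual q).ofConv a = skew q 1 0 a := rfl
lemma kDual_apply (a : Pol q) : (kDual q).ofConv a = kChar q a := rfl
lemma kiDual_apply (a : Pol q) : (kiDual q).ofConv a = kiChar q a := rfl

lemma skew_one (x y : ℂ) : skew q x y 1 = 0 := by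
  simpa using skew_algebraMap (q := q) x y 1

/-! ### Compatibility of the actions with the involution and the Haar state -/

lemma conj_qh (q : Param) : (starRingEnd ℂ) (qh q) = qh q := by simp [qh]

lemma del_ki_star (a : Pol q) : del (Uq.ki q) (star a) = star (del (Uq.k q) a) := by
  induction a using Pol.induct with
  | hs z => simp [Pol.star_algebraMap', del_algebraMap, pairing_k, pairing_ki, kDual_apply,
      kiDual_apply]
  | h1 => simp [del_al, del_als, pairing_k, pairing_ki, kDual_apply, kiDual_apply, conj_qh]
  | h2 => simp [del_al, del_als, pairing_k, pairing_ki, kDual_apply, kiDual_apply, conj_qh]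
  | h3 => simp [del_ga, del_gas, pairing_k, pairing_ki, kDual_apply, kiDual_apply, conj_qh]
  | h4 => simp [del_ga, del_gas, pairing_k, pairing_ki, kDual_apply, kiDual_apply, conj_qh]
  | hadd x y hx hy => simp only [star_add, map_add, hx, hy]
  | hmul x y hx hy => simp only [star_mul, del_ki_mul, del_k_mul, hx, hy]

lemma del_k_star (a : Pol q) : del (Uq.k q) (star a) = star (del (Uq.ki q) a) := by
  rw [← star_star (del (Uq.k q) (star a)), ← del_ki_star, star_star]

/-- An instance of `∂_ω(a*) = (∂_{Ŝ(ω)*} a)*` with `e* = f`. The involution reverses products and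
exchanges `k` with `k⁻¹`, so it respects the twisted Leibniz rule and only the generators need
checking. -/
lemma del_f_star (a : Pol q) : del (Uq.f q) (star a) = -(qc q • star (del (Uq.e q) a)) := by
  have h0 := qc_ne_zero q
  induction a using Pol.induct with
  | hs z => simp [Pol.star_algebraMap', del_algebraMap, pairing_e, pairing_f, eDual_apply,
      fDual_apply, skew_one]
  | h1 => simp [del_al, del_als, pairing_e, pairing_f, eDual_apply, fDual_apply]
  | h2 => simp [del_al, del_als, pairing_e, pairing_f, eDual_apply, fDual_apply, h0]
  | h3 => simp [del_ga, del_gas, pairing_e, pairing_f, eDual_apply, fDual_apply]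
  | h4 =>
    simp [del_ga, del_gas, pairing_e, pairing_f, eDual_apply, fDual_apply, conj_qc, h0, smul_smul]
  | hadd x y hx hy => simp only [star_add, map_add, hx, hy]; module
  | hmul x y hx hy =>
    simp only [star_mul, del_f_mul, del_e_mul, hx, hy, del_ki_star, del_k_star, star_add,
      neg_mul, mul_neg, smul_mul_assoc, mul_smul_comm]
    module

/-- Both `h(∂_ω a)` and `ω((h ⊗ ι)Δ(a))` are `(h ⊗ ω)Δ(a)`, and left invariance evaluates the
latter. -/
lemma HaarState.fn_del (h : HaarState q) (ω : Uq q) (a : Pol q) :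
    h.fn (del ω a) = (pairing q ω).ofConv 1 * h.fn a := by
  have h1 : h.fn (del ω a) = (pairing q ω).ofConv (TensorProduct.lid ℂ (Pol q)
      (LinearMap.rTensor (Pol q) h.fn (Coalgebra.comul a))) := by
    rw [del, lact_apply]
    change _ = (pairing q ω).ofConv (TensorProduct.lid ℂ (Pol q)
      (LinearMap.rTensor (Pol q) h.fn (Pol.comulHom q a)))
    generalize Pol.comulHom q a = t
    induction t with
    | zero => simp
    | add x y hx hy => simp only [map_add, hx, hy]
    | tmul a b => simp [mul_comm]
  rw [h1, h.inv_left, map_smul, smul_eq_mul, mul_comm]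

lemma mem_wt_ki {n : ℤ} {a : Pol q} (ha : a ∈ wt q n) :
    del (Uq.ki q) a = (qh q ^ n)⁻¹ • a := by
  have h0 : qh q ^ n ≠ 0 := zpow_ne_zero _ (qh_ne_zero q)
  have := del_one a
  rw [← (Uq.sat q).rel2, del_mul, mem_wt.1 ha, map_smul] at this
  rw [← this, smul_smul, inv_mul_cancel₀ h0, one_smul, this]

/-- `∂_e` and `∂_f` are formally adjoint to each other. -/
lemma fn_star_del_e_mul (h : HaarState q) {n : ℤ} {a b : Pol q} (ha : a ∈ wt q n)
    (hb : b ∈ wt q (n + 2)) :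
    h.fn (star (del (Uq.e q) a) * b) = h.fn (star a * del (Uq.f q) b) := by
  have h0 := qh_ne_zero q
  -- Since `f(1) = 0`, the two Leibniz terms cancel under `h`. The factor `q` from `∂_f(a*)`
  -- compensates the weight difference `2` between `a` and `b`.
  have key := h.fn_del (Uq.f q) (star a * b)
  rw [del_f_mul, del_f_star, del_k_star, mem_wt_ki ha, mem_wt_ki hb, pairing_f, fDual_apply,
    skew_one] at key
  simp only [star_smul, neg_mul, smul_mul_assoc, mul_smul_comm, map_add, map_neg, map_smul,
    smul_eq_mul, zero_mul, zpow_add₀ h0, ← qh_mul_qh, mul_inv, zpow_ofNat] at key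
  have hz : qh q ^ n ≠ 0 := zpow_ne_zero _ h0
  simp only [Complex.star_def, map_inv₀, map_zpow₀, conj_qh] at key
  field_simp at key
  linear_combination -key

/-! ### The action of the Casimir element -/

/-- The fundamental corepresentation `(α, -qγ*; γ, α*)`. -/
def fundRep (q : Param) : Matrix (Fin 2) (Fin 2) (Pol q) :=
  !![Pol.al q, -(qc q • Pol.gas q); Pol.ga q, Pol.als q]

/-- The constant `c = q^{-1/2}(q - q⁻¹)`. -/
def coef (q : Param) : ℂ := (qh q)⁻¹ * (qc q - (qc q)⁻¹)

/-- The matrix `(k, c d; 0, k⁻¹)` acting from the left, where `c` is `coef q`. -/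
def triDel (d : Uq q) (z : Pol q) : Matrix (Fin 2) (Fin 2) (Pol q) :=
  !![del (Uq.k q) z, coef q • del d z; 0, del (Uq.ki q) z]

/-- The matrix `(k, c d; 0, k⁻¹)` acting from the right, where `c` is `coef q`. -/
def triRdel (d : Uq q) (z : Pol q) : Matrix (Fin 2) (Fin 2) (Pol q) :=
  !![rdel (Uq.k q) z, coef q • rdel d z; 0, rdel (Uq.ki q) z]

/-- The corner entry of the matrix product is exactly the twisted Leibniz rule. Multiplicativity is
what lets the intertwining relations below be checked on generators. -/
lemma triDel_f_mul (a b : Pol q) :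
    triDel (Uq.f q) (a * b) = triDel (Uq.f q) a * triDel (Uq.f q) b := by
  simp [triDel, del_k_mul, del_ki_mul, del_f_mul, smul_add, add_comm]
lemma triDel_e_mul (a b : Pol q) :
    triDel (Uq.e q) (a * b) = triDel (Uq.e q) a * triDel (Uq.e q) b := by
  simp [triDel, del_k_mul, del_ki_mul, del_e_mul, smul_add, add_comm]
lemma triRdel_f_mul (a b : Pol q) :
    triRdel (Uq.f q) (a * b) = triRdel (Uq.f q) a * triRdel (Uq.f q) b := by
  simp [triRdel, rdel_k_mul, rdel_ki_mul, rdel_f_mul, smul_add, add_comm]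
lemma triRdel_e_mul (a b : Pol q) :
    triRdel (Uq.e q) (a * b) = triRdel (Uq.e q) a * triRdel (Uq.e q) b := by
  simp [triRdel, rdel_k_mul, rdel_ki_mul, rdel_e_mul, smul_add, add_comm]

lemma triDel_add (d : Uq q) (a b : Pol q) : triDel d (a + b) = triDel d a + triDel d b := by
  simp [triDel]
lemma triRdel_add (d : Uq q) (a b : Pol q) : triRdel d (a + b) = triRdel d a + triRdel d b := by
  simp [triRdel]

lemma matrix_fin_two_congr {R : Type*} {a b c d a' b' c' d' : R} (ha : a = a') (hb : b = b')
    (hc : c = c') (hd : d = d') : !![a, b; c, d] = !![a', b'; c', d'] := by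
  rw [ha, hb, hc, hd]

/-- Dual form of `L Δ(ω) = Δ^op(ω) L`, where `L = (k, c f; 0, k⁻¹)` is an R-matrix with one leg in
the fundamental representation. Both triangular matrices are multiplicative in `z`, so the
generators suffice. The upper left entry at `z = γ` already fixes `c`, through `q^{-1/2} + q c =
q^{3/2}`. -/
lemma triRdel_f_mul_fundRep (z : Pol q) :
    triRdel (Uq.f q) z * fundRep q = fundRep q * triDel (Uq.f q) z := by
  have hsat := Pol.sat q
  have h0 := qc_ne_zero q
  have h0' := qh_ne_zero q
  have hq : qc q = qh q ^ 2 := by rw [sq, qh_mul_qh]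
  have r1 : Pol.als q * Pol.al q = 1 - Pol.gas q * Pol.ga q := by rw [← hsat.rel1]; abel
  have r2 : Pol.al q * Pol.als q = 1 - (qc q ^ 2) • (Pol.gas q * Pol.ga q) := by
    rw [← hsat.rel2]; abel
  induction z using Pol.induct with
  | hs z =>
    simp only [triRdel, triDel, fundRep, del_algebraMap, rdel_algebraMap, pairing_f, pairing_k,
      pairing_ki, fDual_apply, kDual_apply, kiDual_apply, skew_one, map_one, one_smul, zero_smul,
      smul_zero, Matrix.mul_fin_two]
    simp [Algebra.algebraMap_eq_smul_one, smul_comm z]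
  | hadd x y hx hy => rw [triRdel_add, triDel_add, add_mul, mul_add, hx, hy]
  | hmul x y hx hy =>
    rw [triRdel_f_mul, triDel_f_mul, mul_assoc, hy, ← mul_assoc, hx, mul_assoc]
  | _ =>
    simp only [triRdel, triDel, fundRep, Matrix.mul_fin_two, del_al, del_als, del_ga, del_gas,
      rdel_al, rdel_als, rdel_ga, rdel_gas, pairing_f, pairing_k, pairing_ki, fDual_apply,
      kDual_apply, kiDual_apply, skew_al, skew_als, skew_ga, skew_gas, kChar_al, kChar_als,
      kChar_ga, kChar_gas, kiChar_al, kiChar_als, kiChar_ga, kiChar_gas, zero_smul, mul_zero,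
      sub_zero, add_zero, zero_add, smul_zero, zero_sub, mul_one, one_smul]
    simp only [coef, smul_mul_assoc, mul_smul_comm, mul_neg, neg_mul, r1, r2, hsat.rel4,
      hsat.rel5, hsat.rel4', hsat.rel5', ← hsat.rel3, zero_mul, smul_zero,
      smul_neg, add_zero, zero_add, neg_zero]
    -- With every power of `q` written through `q^{1/2}`, each coefficient is a rational identity in
    -- one variable.
    refine matrix_fin_two_congr ?_ ?_ ?_ ?_ <;> simp only [hq] <;> match_scalars <;>
      first | ring1 | (field_simp; ring1) | field_simp

/-- The companion relation `Δ(ω) N = N Δ^op(ω)` for the lower triangular `N = (k, 0; c e, k⁻¹)`. It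
is stated with transposes because the entries of `𝒜` must keep their order in the products. -/
lemma triDel_e_mul_fundRep (z : Pol q) :
    triDel (Uq.e q) z * (fundRep q).transpose = (fundRep q).transpose * triRdel (Uq.e q) z := by
  have hsat := Pol.sat q
  have h0 := qc_ne_zero q
  have h0' := qh_ne_zero q
  have hq : qc q = qh q ^ 2 := by rw [sq, qh_mul_qh]
  have r1 : Pol.als q * Pol.al q = 1 - Pol.gas q * Pol.ga q := by rw [← hsat.rel1]; abel
  have r2 : Pol.al q * Pol.als q = 1 - (qc q ^ 2) • (Pol.gas q * Pol.ga q) := by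
    rw [← hsat.rel2]; abel
  have ht : (fundRep q).transpose =
      !![Pol.al q, Pol.ga q; -(qc q • Pol.gas q), Pol.als q] := by
    ext i j; fin_cases i <;> fin_cases j <;> rfl
  induction z using Pol.induct with
  | hs z =>
    simp only [triRdel, triDel, ht, del_algebraMap, rdel_algebraMap, pairing_e, pairing_k,
      pairing_ki, eDual_apply, kDual_apply, kiDual_apply, skew_one, map_one, one_smul, zero_smul,
      smul_zero, Matrix.mul_fin_two]
    simp [Algebra.algebraMap_eq_smul_one, smul_comm z]
  | hadd x y hx hy => rw [triRdel_add, triDel_add, add_mul, mul_add, hx, hy]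
  | hmul x y hx hy =>
    rw [triRdel_e_mul, triDel_e_mul, mul_assoc, hy, ← mul_assoc, hx, mul_assoc]
  | _ =>
    simp only [triRdel, triDel, ht, Matrix.mul_fin_two, del_al, del_als, del_ga, del_gas,
      rdel_al, rdel_als, rdel_ga, rdel_gas, pairing_e, pairing_k, pairing_ki, eDual_apply,
      kDual_apply, kiDual_apply, skew_al, skew_als, skew_ga, skew_gas, kChar_al, kChar_als,
      kChar_ga, kChar_gas, kiChar_al, kiChar_als, kiChar_ga, kiChar_gas, zero_smul, mul_zero,
      sub_zero, add_zero, zero_add, smul_zero, zero_sub]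
    simp only [coef, smul_mul_assoc, mul_smul_comm, mul_neg, neg_mul, r1, r2, hsat.rel4,
      hsat.rel5, hsat.rel4', hsat.rel5', ← hsat.rel3, zero_mul, smul_zero,
      smul_neg, neg_neg, add_zero, zero_add, neg_zero]
    refine matrix_fin_two_congr ?_ ?_ ?_ ?_ <;> simp only [hq] <;> match_scalars <;>
      first | ring1 | (field_simp; ring1) | field_simp

lemma qc_sub_inv_ne_zero (q : Param) : qc q - (qc q)⁻¹ ≠ 0 := by
  have h3 : 1 < (q : ℝ)⁻¹ := (one_lt_inv₀ q.2.1).2 q.2.2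
  have : (q : ℝ) - (q : ℝ)⁻¹ ≠ 0 := by linarith [q.2.2]
  simpa [qc] using (by exact_mod_cast this : (((q : ℝ) - (q : ℝ)⁻¹ : ℝ) : ℂ) ≠ 0)

/-- The quantum trace of the matrix `(k, c f; 0, k⁻¹) (k, 0; c e, k⁻¹)`. -/
def qTrace (q : Param) : Uq q :=
  Uq.k q * Uq.k q + (coef q ^ 2) • (Uq.f q * Uq.e q) + (qc q ^ 2)⁻¹ • (Uq.ki q * Uq.ki q)

/-- By the two intertwining relations `M = L N` commutes with `Δ^op(ω)`, whence its quantum trace is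
central. Working directly with the actions on `𝒜` avoids having to know that `U_q(su_2)` separates
the points of `𝒜`. -/
lemma rdel_qTrace (x : Pol q) : rdel (qTrace q) x = del (qTrace q) x := by
  have hsat := Pol.sat q
  have h0 := qc_ne_zero q
  have r1 : Pol.als q * Pol.al q = 1 - Pol.gas q * Pol.ga q := by rw [← hsat.rel1]; abel
  have r2 : Pol.al q * Pol.als q = 1 - (qc q ^ 2) • (Pol.gas q * Pol.ga q) := by
    rw [← hsat.rel2]; abel
  have ht : (fundRep q).transpose =
      !![Pol.al q, Pol.ga q; -(qc q • Pol.gas q), Pol.als q] := by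
    ext i j; fin_cases i <;> fin_cases j <;> rfl
  have hf := fun z => triRdel_f_mul_fundRep (q := q) z
  have he := fun z => triDel_e_mul_fundRep (q := q) z
  simp only [triRdel, triDel, fundRep, Matrix.mul_fin_two, zero_mul, mul_zero, add_zero,
    zero_add] at hf
  simp only [triRdel, triDel, ht, Matrix.mul_fin_two, zero_mul, mul_zero, add_zero,
    zero_add] at he
  have f11 := fun z => congrFun (congrFun (hf z) 0) 0
  have f12 := fun z => congrFun (congrFun (hf z) 0) 1
  have f21 := fun z => congrFun (congrFun (hf z) 1) 0
  have f22 := fun z => congrFun (congrFun (hf z) 1) 1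
  have e11 := fun z => congrFun (congrFun (he z) 0) 0
  have e12 := fun z => congrFun (congrFun (he z) 0) 1
  have e21 := fun z => congrFun (congrFun (he z) 1) 0
  have e22 := fun z => congrFun (congrFun (he z) 1) 1
  simp only [Matrix.of_apply, Matrix.cons_val_zero, Matrix.cons_val_one, Matrix.cons_val',
    Matrix.cons_val_fin_one] at f11 f12 f21 f22 e11 e12 e21 e22
  clear hf he ht
  -- `LM` and `RM` collect the left and right actions on `x` of the entries of `M`; compositions on
  -- the right appear in reverse order.
  set LM11 := del (Uq.k q) (del (Uq.k q) x) + coef q ^ 2 • del (Uq.f q) (del (Uq.e q) x) with hL11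
  set RM11 := rdel (Uq.k q) (rdel (Uq.k q) x) +
    coef q ^ 2 • rdel (Uq.e q) (rdel (Uq.f q) x) with hR11
  set LM21 := coef q • del (Uq.ki q) (del (Uq.e q) x)
  set RM21 := coef q • rdel (Uq.e q) (rdel (Uq.ki q) x)
  set LM12 := coef q • del (Uq.f q) (del (Uq.ki q) x)
  set RM12 := coef q • rdel (Uq.ki q) (rdel (Uq.f q) x)
  set LM22 := del (Uq.ki q) (del (Uq.ki q) x)
  set RM22 := rdel (Uq.ki q) (rdel (Uq.ki q) x)
  -- The four identities say `∑_j u_{ij} LM_{jk} = ∑_j u_{jk} RM_{ij}`. The `f`-relation applied to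
  -- left translates and the `e`-relation applied to right translates yield the same mixed terms,
  -- because the two actions commute.
  have i11 : Pol.al q * LM11 + -(qc q • Pol.gas q) * LM21 =
      Pol.al q * RM11 + Pol.ga q * RM12 := by
    have a1 := f11 (del (Uq.k q) x)
    have a2 := f12 (coef q • del (Uq.e q) x)
    have b1 := e11 (rdel (Uq.k q) x)
    have b2 := e12 (coef q • rdel (Uq.f q) x)
    simp only [map_smul, ← del_rdel] at a1 a2 b1 b2
    simp only [hL11, hR11, LM21, RM12, mul_add, sq, ← smul_smul]
    linear_combination (norm := module) -a1 - a2 + b1 + b2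
  have i21 : Pol.ga q * LM11 + Pol.als q * LM21 = Pol.al q * RM21 + Pol.ga q * RM22 := by
    have a1 := f21 (del (Uq.k q) x)
    have a2 := f22 (coef q • del (Uq.e q) x)
    have b2 := e12 (rdel (Uq.ki q) x)
    simp only [map_smul, ← del_rdel] at a1 a2 b2
    simp only [hL11, LM21, RM21, RM22, mul_add, sq, ← smul_smul]
    linear_combination (norm := module) -a1 - a2 + b2
  have i12 : Pol.al q * LM12 + -(qc q • Pol.gas q) * LM22 =
      -(qc q • Pol.gas q) * RM11 + Pol.als q * RM12 := by
    have a2 := f12 (del (Uq.ki q) x)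
    have b1 := e21 (rdel (Uq.k q) x)
    have b2 := e22 (coef q • rdel (Uq.f q) x)
    simp only [map_smul, ← del_rdel] at a2 b1 b2
    simp only [LM12, LM22, hR11, RM12, mul_add, sq, ← smul_smul]
    linear_combination (norm := module) - a2 + b1 + b2
  have i22 : Pol.ga q * LM12 + Pol.als q * LM22 =
      -(qc q • Pol.gas q) * RM21 + Pol.als q * RM22 := by
    have a2 := f22 (del (Uq.ki q) x)
    have b2 := e22 (rdel (Uq.ki q) x)
    simp only [← del_rdel] at a2 b2
    simp only [LM12, LM22, RM21, RM22]
    linear_combination (norm := module) - a2 + b2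
  -- Multiplying by the rows of `u⁻¹ = (α*, γ*; -qγ, α)` isolates `LM11` and `LM22`. With weight
  -- `q⁻²` on the second, the coefficients of `RM12` and `RM21` cancel, and those of `RM11` and
  -- `RM22` become `1` and `q⁻²`.
  have j1 := congrArg₂ (fun s t => Pol.als q * s + Pol.gas q * t) i11 i21
  have j2 := congrArg₂ (fun s t => -(qc q • Pol.ga q) * s + Pol.al q * t) i12 i22
  have j := congrArg₂ (fun s t => s + (qc q ^ 2)⁻¹ • t) j1 j2
  simp only [mul_add, ← mul_assoc, mul_smul_comm, smul_mul_assoc, mul_neg, neg_mul, r1, r2,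
    hsat.rel4, hsat.rel5, hsat.rel4', hsat.rel5', ← hsat.rel3, sub_mul, one_mul, smul_add,
    smul_neg, smul_sub, smul_smul, neg_neg] at j
  have hdel : del (qTrace q) x = LM11 + (qc q ^ 2)⁻¹ • LM22 := by
    simp only [qTrace, del_add, del_smul, del_mul, hL11, LM22]
  have hrdel : rdel (qTrace q) x = RM11 + (qc q ^ 2)⁻¹ • RM22 := by
    simp only [qTrace, rdel_add, rdel_smul, rdel_mul, hR11, RM22]
  rw [hdel, hrdel]
  have c2 : (qc q ^ 2)⁻¹ * qc q ^ 2 = 1 := by field_simp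
  simp only [c2, one_smul] at j
  have e1 : LM11 + (qc q ^ 2)⁻¹ • LM22 = RM11 + (qc q ^ 2)⁻¹ • RM22 := by
    rw [← sub_eq_zero] at j ⊢
    rw [← j]
    match_scalars <;> field_simp <;> ring1
  exact e1.symm

lemma coef_sq (q : Param) : coef q ^ 2 = (qc q)⁻¹ * (qc q - (qc q)⁻¹) ^ 2 := by
  rw [coef, mul_pow, sq (qh q)⁻¹, ← mul_inv, qh_mul_qh]

lemma casimir_eq (q : Param) : Uq.casimir q =
    (qc q * ((qc q - (qc q)⁻¹) ^ 2)⁻¹) • qTrace q -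
      (2 * ((qc q - (qc q)⁻¹) ^ 2)⁻¹) • (1 : Uq q) := by
  have hs := Uq.sat q
  have h0 := qc_ne_zero q
  have hh := qh_ne_zero q
  have hd := qc_sub_inv_ne_zero q
  have hi : (qh q)⁻¹ * (qh q)⁻¹ = (qc q)⁻¹ := by rw [← mul_inv, qh_mul_qh]
  rw [Uq.casimir, qTrace, coef_sq]
  set d := qc q - (qc q)⁻¹
  simp only [sq (d⁻¹ • _), smul_mul_smul_comm, sub_mul, mul_sub, hs.rel1, hs.rel2, hi, qh_mul_qh,
    mul_inv_cancel₀ hh, inv_mul_cancel₀ hh, one_smul]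
  match_scalars <;> field_simp <;> ring1

/-- The antihomomorphism turns `fe` into `ef` and exchanges `k` with `k⁻¹` in the Cartan part; the
relation for `ef - fe` makes the two changes cancel. -/
lemma antipodeInv_casimir (q : Param) :
    (Uq.antipodeInv q (Uq.casimir q)).unop = Uq.casimir q := by
  have hs := Uq.sat q
  have h0 := qc_ne_zero q
  have hh := qh_ne_zero q
  have hd := qc_sub_inv_ne_zero q
  have hi : (qh q)⁻¹ * (qh q)⁻¹ = (qc q)⁻¹ := by rw [← mul_inv, qh_mul_qh]
  have hef : Uq.e q * Uq.f q = Uq.f q * Uq.e q +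
      (qc q - (qc q)⁻¹)⁻¹ • (Uq.k q * Uq.k q - Uq.ki q * Uq.ki q) := by
    rw [← sq, ← sq, ← hs.rel5]; abel
  have h1 : (Uq.antipodeInv q (Uq.casimir q)).unop = Uq.e q * Uq.f q +
      ((qc q - (qc q)⁻¹)⁻¹ • (qh q • Uq.ki q - (qh q)⁻¹ • Uq.k q)) ^ 2 := by
    simp [Uq.casimir, Uq.antipodeInv, Uq.twist, smul_smul, h0]
  rw [h1, hef, Uq.casimir]
  simp only [sq (_ • _), smul_mul_smul_comm, sub_mul, mul_sub, hs.rel1, hs.rel2, hi, qh_mul_qh,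
    mul_inv_cancel₀ hh, inv_mul_cancel₀ hh, one_smul]
  -- Puts the commutator coefficient over the denominator `(q - q⁻¹)²` of the Cartan part, as the
  -- coefficients of `k²` and `k⁻²` require.
  have hD : (qc q - (qc q)⁻¹)⁻¹ =
      (qc q - (qc q)⁻¹)⁻¹ * (qc q - (qc q)⁻¹)⁻¹ * (qc q - (qc q)⁻¹) := by
    rw [mul_assoc, inv_mul_cancel₀ hd, mul_one]
  match_scalars
  · ring1
  · linear_combination hD
  · linear_combination -hD
  · ring1

/-- The Casimir element acts in the same way from both sides. -/
lemma rho_casimir (x : Pol q) : rho (Uq.casimir q) x = del (Uq.casimir q) x := by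
  have h1 : rho (Uq.casimir q) x = rdel (Uq.casimir q) x := by
    rw [rho, antipodeInv_casimir, rdel]
  rw [h1, casimir_eq]
  simp only [rdel_sub, del_sub, rdel_smul, del_smul, rdel_qTrace, rdel_one, del_one]

lemma del_casimir {n : ℤ} {x : Pol q} (hx : x ∈ wt q n) :
    del (Uq.casimir q) x = del (Uq.f q) (del (Uq.e q) x) +
      ((qc q - (qc q)⁻¹)⁻¹ * (qh q * qh q ^ n - (qh q)⁻¹ * (qh q ^ n)⁻¹)) ^ 2 • x := by
  have hk := mem_wt.1 hx
  have hki := mem_wt_ki hx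
  simp only [Uq.casimir, sq (_ • _), del_add, del_mul, del_smul, del_sub, hk, hki, map_smul,
    map_sub]
  module

/-- On weight `-1`, `q^{1/2} k` and `q^{-1/2} k⁻¹` both act as the identity, so the squared term
vanishes. -/
lemma rho_casimir_of_mem_wt_neg_one {x : Pol q} (hx : x ∈ wt q (-1)) :
    rho (Uq.casimir q) x = del (Uq.f q) (del (Uq.e q) x) := by
  have hh := qh_ne_zero q
  rw [rho_casimir, del_casimir hx]
  simp [hh]

/-- On weight `1` the Cartan term and the commutator `ef - fe` both act as the identity, so `fe + 1`
becomes `ef`. -/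
lemma rho_casimir_of_mem_wt_one {x : Pol q} (hx : x ∈ wt q 1) :
    rho (Uq.casimir q) x = del (Uq.e q) (del (Uq.f q) x) := by
  have hh := qh_ne_zero q
  have hd := qc_sub_inv_ne_zero q
  have hi : (qh q)⁻¹ * (qh q)⁻¹ = (qc q)⁻¹ := by rw [← mul_inv, qh_mul_qh]
  have h5 := congrArg (fun ω => del ω x) (Uq.sat q).rel5
  simp only [del_sub, del_smul, del_mul, sq, mem_wt.1 hx, mem_wt_ki hx, map_smul, zpow_one,
    smul_smul, qh_mul_qh, hi, ← sub_smul, inv_mul_cancel₀ hd, one_smul] at h5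
  rw [rho_casimir, del_casimir hx, zpow_one, qh_mul_qh, hi, inv_mul_cancel₀ hd, one_pow, one_smul,
    sub_eq_iff_eq_add'.1 h5]

lemma rhoPol_casimir (q : Param) : rhoPol (Uq.casimir q) = diracPol q ∘ₗ diracPol q := by
  refine LinearMap.ext fun x => Prod.ext (Subtype.ext ?_) (Subtype.ext ?_)
  · exact rho_casimir_of_mem_wt_one x.1.2
  · exact rho_casimir_of_mem_wt_neg_one x.2.2

/-! ### Symmetric, locally finite operators -/

section Symmetric

variable {P H : Type*} [AddCommGroup P] [Module ℂ P] [NormedAddCommGroup H] [InnerProductSpace ℂ H]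

/-- The closure in `H × H` of the graph of `T`, where `j : P → H` is the canonical map. -/
def graphClosure (j : P →ₗ[ℂ] H) (T : P →ₗ[ℂ] P) : Submodule ℂ (H × H) :=
  (LinearMap.range (j.prod (j ∘ₗ T))).topologicalClosure

variable {j : P →ₗ[ℂ] H} {T : P →ₗ[ℂ] P}

lemma mem_graphClosure (a : P) : (j a, j (T a)) ∈ graphClosure j T :=
  Submodule.le_topologicalClosure _ ⟨a, rfl⟩

lemma isClosed_graphClosure : IsClosed (graphClosure j T : Set (H × H)) :=
  Submodule.isClosed_topologicalClosure _

/-- To prove a closed condition on the closure of a graph, it suffices to prove it on the graph. -/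
lemma graphClosure_induction {p : H × H → Prop} (hp : IsClosed {x | p x})
    (h : ∀ a, p (j a, j (T a))) {x : H × H} (hx : x ∈ graphClosure j T) : p x := by
  have : (graphClosure j T : Set (H × H)) ⊆ {x | p x} := by
    refine closure_minimal ?_ hp
    rintro _ ⟨a, rfl⟩
    exact h a
  exact this hx

/-- Symmetry is a closed condition in each variable separately, so it passes to the closure one
variable at a time. -/
lemma inner_graphClosure (hT : ∀ a b, inner ℂ (j (T a)) (j b) = inner ℂ (j a) (j (T b)))
    {x y : H × H} (hx : x ∈ graphClosure j T) (hy : y ∈ graphClosure j T) :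
    (inner ℂ x.2 y.1 : ℂ) = inner ℂ x.1 y.2 := by
  refine graphClosure_induction (p := fun x => (inner ℂ x.2 y.1 : ℂ) = inner ℂ x.1 y.2)
    (isClosed_eq (by fun_prop) (by fun_prop)) (fun a => ?_) hx
  refine graphClosure_induction
    (p := fun y => (inner ℂ (j (T a)) y.1 : ℂ) = inner ℂ (j a) y.2)
    (isClosed_eq (by fun_prop) (by fun_prop)) (fun b => hT a b) hy

/-- Symmetric operators are closable. -/
lemma graphClosure_snd_eq_zero (hj : DenseRange j)
    (hT : ∀ a b, inner ℂ (j (T a)) (j b) = inner ℂ (j a) (j (T b)))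
    (x : H × H) (hx : x ∈ graphClosure j T) (h0 : x.1 = 0) : x.2 = 0 := by
  -- For `(0, y)` in the closure, symmetry makes `y` orthogonal to the dense range of `j`.
  refine hj.eq_zero_of_inner_left (𝕜 := ℂ) fun b => ?_
  have := inner_graphClosure hT hx (mem_graphClosure b)
  simpa [h0] using this

/-- If `T` is symmetric and locally finite, then `T² + 1` has dense range. -/
lemma denseRange_sq_add_one (hj : DenseRange j)
    (hT : ∀ a b, inner ℂ (j (T a)) (j b) = inner ℂ (j a) (j (T b)))
    (hfin : ∀ a, ∃ V : Submodule ℂ P, FiniteDimensional ℂ V ∧ a ∈ V ∧ ∀ v ∈ V, T v ∈ V) :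
    DenseRange fun a => j (T (T a)) + j a := by
  refine hj.mono ?_
  rintro _ ⟨a, rfl⟩
  obtain ⟨V, hV, haV, hTV⟩ := hfin a
  let S : P →ₗ[ℂ] H := j ∘ₗ (T ∘ₗ T) + j
  have hS : V.map S ≤ V.map j := by
    rintro _ ⟨v, hv, rfl⟩
    exact ⟨T (T v) + v, V.add_mem (hTV _ (hTV _ hv)) hv, by simp [S]⟩
  -- The argument takes place in the image `j(V)`, since `j` is not assumed injective.
  have hle : V.map j ≤ V.map S := by
    have : FiniteDimensional ℂ (V.map S) := inferInstance
    intro w hw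
    -- The residual `w - z` is some `j v` with `v ∈ V`, and it is orthogonal to `S v`. By symmetry
    -- this inner product is `‖j(Tv)‖² + ‖j v‖²`, so the residual is zero.
    set z := (V.map S).starProjection w with hz
    have hzS : z ∈ V.map S := Submodule.starProjection_apply_mem _ _
    obtain ⟨v, hv, hvz⟩ : w - z ∈ V.map j := (V.map j).sub_mem hw (hS hzS)
    have horth : ∀ y ∈ V.map S, (inner ℂ (w - z) y : ℂ) = 0 := fun y hy =>
      Submodule.starProjection_inner_eq_zero w y hy
    have h1 := horth _ ⟨v, hv, rfl⟩
    have h2 : (inner ℂ (j v) (j (T (T v)) + j v) : ℂ) = 0 := by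
      rw [← hvz] at h1; exact h1
    rw [inner_add_right, ← hT, inner_self_eq_norm_sq_to_K, inner_self_eq_norm_sq_to_K] at h2
    have h3 : ‖j (T v)‖ ^ 2 + ‖j v‖ ^ 2 = 0 := Complex.ofReal_injective (by simpa using h2)
    have h4 : ‖j v‖ = 0 := by nlinarith [sq_nonneg ‖j (T v)‖, sq_nonneg ‖j v‖]
    have : w - z = 0 := by rw [← hvz]; exact norm_eq_zero.1 h4
    rw [sub_eq_zero.1 this]; exact hzS
  obtain ⟨v, -, hv⟩ := hle ⟨a, haV, rfl⟩
  exact ⟨v, by simpa [S] using hv⟩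

/-- The cross term `⟨T²a, a⟩` is `‖Ta‖²`, hence nonnegative. Consequently `T² + 1` bounds `a`, `Ta`
and `T²a` simultaneously. -/
lemma norm_sq_add_one (hT : ∀ a b, inner ℂ (j (T a)) (j b) = inner ℂ (j a) (j (T b))) (a : P) :
    ‖j (T (T a)) + j a‖ ^ 2 = ‖j (T (T a))‖ ^ 2 + 2 * ‖j (T a)‖ ^ 2 + ‖j a‖ ^ 2 := by
  rw [@norm_add_sq ℂ, hT, inner_self_eq_norm_sq_to_K]
  norm_cast

open Filter Topology in
/-- The square of the closure of a symmetric, locally finite operator is the closure of the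
square. -/
lemma mem_graphClosure_sq [CompleteSpace H] (hj : DenseRange j)
    (hT : ∀ a b, inner ℂ (j (T a)) (j b) = inner ℂ (j a) (j (T b)))
    (hfin : ∀ a, ∃ V : Submodule ℂ P, FiniteDimensional ℂ V ∧ a ∈ V ∧ ∀ v ∈ V, T v ∈ V)
    (x z : H) : (x, z) ∈ graphClosure j (T ∘ₗ T) ↔
      ∃ y, (x, y) ∈ graphClosure j T ∧ (y, z) ∈ graphClosure j T := by
  -- the convergence of `a n` in the graph norm of `T²` follows from that of `(T² + 1) (a n)`
  have key : ∀ (a : ℕ → P) (w : H), Tendsto (fun n => j (T (T (a n))) + j (a n)) atTop (𝓝 w) →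
      ∃ x y, Tendsto (fun n => j (a n)) atTop (𝓝 x) ∧ Tendsto (fun n => j (T (a n))) atTop (𝓝 y) ∧
        Tendsto (fun n => j (T (T (a n)))) atTop (𝓝 (w - x)) := by
    intro a w hw
    have hc := Metric.cauchySeq_iff'.1 hw.cauchySeq
    have bound : ∀ b : P, ‖j b‖ ≤ ‖j (T (T b)) + j b‖ ∧ ‖j (T b)‖ ≤ ‖j (T (T b)) + j b‖ := by
      intro b
      have := norm_sq_add_one hT b
      constructor <;> refine le_of_sq_le_sq ?_ (norm_nonneg _) <;>
        nlinarith [sq_nonneg ‖j (T (T b))‖, sq_nonneg ‖j (T b)‖, sq_nonneg ‖j b‖]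
    have c1 : CauchySeq fun n => j (a n) := by
      refine Metric.cauchySeq_iff'.2 fun ε hε => ?_
      obtain ⟨N, hN⟩ := hc ε hε
      refine ⟨N, fun n hn => lt_of_le_of_lt ?_ (hN n hn)⟩
      have := (bound (a n - a N)).1
      rw [dist_eq_norm, dist_eq_norm, add_sub_add_comm]
      simpa only [map_sub] using this
    have c2 : CauchySeq fun n => j (T (a n)) := by
      refine Metric.cauchySeq_iff'.2 fun ε hε => ?_
      obtain ⟨N, hN⟩ := hc ε hε
      refine ⟨N, fun n hn => lt_of_le_of_lt ?_ (hN n hn)⟩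
      have := (bound (a n - a N)).2
      rw [dist_eq_norm, dist_eq_norm, add_sub_add_comm]
      simpa only [map_sub] using this
    obtain ⟨x, hx⟩ := cauchySeq_tendsto_of_complete c1
    obtain ⟨y, hy⟩ := cauchySeq_tendsto_of_complete c2
    exact ⟨x, y, hx, hy, by simpa using hw.sub hx⟩
  have lim : ∀ (S : P →ₗ[ℂ] P) (b : ℕ → P) (u v : H), Tendsto (fun n => j (b n)) atTop (𝓝 u) →
      Tendsto (fun n => j (S (b n))) atTop (𝓝 v) → (u, v) ∈ graphClosure j S :=
    fun S b u v hu hv => isClosed_graphClosure.mem_of_tendsto (hu.prodMk_nhds hv)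
      (Eventually.of_forall fun n => mem_graphClosure (b n))
  constructor
  -- Convergence of `a n` and `T²(a n)` forces that of `T(a n)`, whose limit is the intermediate
  -- vector `y`.
  · intro hxz
    obtain ⟨s, hs, hlim⟩ := mem_closure_iff_seq_limit.1 hxz
    choose a ha using hs
    have h1 : Tendsto (fun n => j (a n)) atTop (𝓝 x) := by
      have := (continuous_fst.tendsto _).comp hlim
      convert this using 2 with n
      rw [Function.comp_apply, ← ha n]; rfl
    have h2 : Tendsto (fun n => j (T (T (a n)))) atTop (𝓝 z) := by
      have := (continuous_snd.tendsto _).comp hlim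
      convert this using 2 with n
      rw [Function.comp_apply, ← ha n]; rfl
    obtain ⟨x', y, -, hy, -⟩ := key a _ (h2.add h1)
    exact ⟨y, lim T a x y h1 hy, lim T (fun n => T (a n)) y z hy h2⟩
  -- Density lets `(T² + 1)(a n)` approach `z + x`. The limit `x'` of `a n` lies in the domain of
  -- the closure of `T²`; it remains to prove `x = x'`.
  · rintro ⟨y, hxy, hyz⟩
    obtain ⟨s, hs, hlim⟩ := mem_closure_iff_seq_limit.1
      ((denseRange_sq_add_one hj hT hfin) (z + x))
    choose a ha using hs
    have hw : Tendsto (fun n => j (T (T (a n))) + j (a n)) atTop (𝓝 (z + x)) := by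
      simpa only [ha] using hlim
    obtain ⟨x', y', h1, h2, h3⟩ := key a _ hw
    have g1 := (graphClosure j T).sub_mem hxy (lim T a x' y' h1 h2)
    have g2 := (graphClosure j T).sub_mem hyz (lim T (fun n => T (a n)) y' _ h2 h3)
    have g3 := lim (T ∘ₗ T) a x' _ h1 h3
    -- The closure of `T` sends `x - x'` to `y - y'` and `y - y'` to `-(x - x')`, so symmetry gives
    -- `‖y - y'‖² = -‖x - x'‖²` and both vanish.
    have i1 := inner_graphClosure hT g1 g2
    simp only [Prod.mk_sub_mk] at i1
    have e1 : z - (z + x - x') = -(x - x') := by abel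
    rw [e1, inner_neg_right, inner_self_eq_norm_sq_to_K, inner_self_eq_norm_sq_to_K] at i1
    have i2 : ‖y - y'‖ ^ 2 = -‖x - x'‖ ^ 2 := by exact_mod_cast i1
    have i3 : ‖x - x'‖ = 0 := by nlinarith [sq_nonneg ‖y - y'‖, sq_nonneg ‖x - x'‖]
    have i4 : x = x' := sub_eq_zero.1 (norm_eq_zero.1 i3)
    subst i4
    simpa using g3

end Symmetric

/-! ### The Dirac operator on polynomial spinors -/

lemma inner_toL2 (h : HaarState q) (a b : Pol q) :
    (inner ℂ (toL2 h a) (toL2 h b) : ℂ) = h.fn (star a * b) :=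
  UniformSpace.Completion.inner_coe _ _

lemma denseRange_toL2w (h : HaarState q) (n : ℤ) : DenseRange (toL2w h n) := by
  intro x
  rw [closure_subtype]
  refine closure_mono ?_ x.2
  rintro _ ⟨a, ha, rfl⟩
  exact ⟨toL2w h n ⟨a, ha⟩, ⟨_, rfl⟩, rfl⟩

lemma denseRange_toSpinor (h : HaarState q) : DenseRange (toSpinor h) := by
  have h1 : DenseRange (Prod.map (toL2w h 1) (toL2w h (-1))) :=
    (denseRange_toL2w h 1).prodMap (denseRange_toL2w h (-1))
  exact ((WithLp.prodContinuousLinearEquiv 2 ℂ (L2w h 1) (L2w h (-1))).symm.surjective.denseRange).comp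
    h1 (WithLp.prodContinuousLinearEquiv 2 ℂ (L2w h 1) (L2w h (-1))).symm.continuous

lemma inner_toSpinor (h : HaarState q) (a b : PolSpinor q) :
    (inner ℂ (toSpinor h a) (toSpinor h b) : ℂ) =
      h.fn (star (a.1 : Pol q) * b.1) + h.fn (star (a.2 : Pol q) * b.2) := by
  rw [WithLp.prod_inner_apply, ← inner_toL2, ← inner_toL2]
  rfl

lemma inner_diracPol (h : HaarState q) (a b : PolSpinor q) :
    (inner ℂ (toSpinor h (diracPol q a)) (toSpinor h b) : ℂ) =
      inner ℂ (toSpinor h a) (toSpinor h (diracPol q b)) := by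
  have h1 : h.fn (star (del (Uq.e q) a.2) * b.1) = h.fn (star (a.2 : Pol q) * del (Uq.f q) b.1) :=
    fn_star_del_e_mul h a.2.2 b.1.2
  have h2 : h.fn (star (del (Uq.f q) a.1) * b.2) = h.fn (star (a.1 : Pol q) * del (Uq.e q) b.2) := by
    -- The other half of the adjointness is the complex conjugate of the first, because `h(x*)` is
    -- the conjugate of `h(x)`.
    have := congrArg (starRingEnd ℂ) (fn_star_del_e_mul h b.2.2 a.1.2)
    rw [← h.map_star, ← h.map_star, star_mul, star_mul, star_star, star_star] at this
    exact this.symm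
  rw [inner_toSpinor, inner_toSpinor]
  change h.fn (star (del (Uq.e q) a.2) * b.1) + h.fn (star (del (Uq.f q) a.1) * b.2) =
    h.fn (star (a.1 : Pol q) * del (Uq.e q) b.2) + h.fn (star (a.2 : Pol q) * del (Uq.f q) b.1)
  rw [h1, h2, add_comm]

/-- Writing `Δ(a)` as a finite sum of elementary tensors, every `(ι ⊗ φ)Δ(a)` lies in the span of
the left legs. -/
lemma exists_finiteDimensional_lact (a : Pol q) :
    ∃ W : Submodule ℂ (Pol q), FiniteDimensional ℂ W ∧ ∀ φ : Dual q, lact φ a ∈ W := by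
  simp only [lact_apply]
  generalize Pol.comulHom q a = t
  induction t with
  | zero => exact ⟨⊥, inferInstance, by simp⟩
  | add x y hx hy =>
    obtain ⟨W, hW, hx⟩ := hx
    obtain ⟨W', hW', hy⟩ := hy
    refine ⟨W ⊔ W', inferInstance, fun φ => ?_⟩
    rw [map_add, map_add]
    exact add_mem (Submodule.mem_sup_left (hx φ)) (Submodule.mem_sup_right (hy φ))
  | tmul a b =>
    refine ⟨ℂ ∙ a, inferInstance, fun φ => ?_⟩
    simpa using Submodule.smul_mem _ _ (Submodule.mem_span_singleton_self a)

/-- The orbit `{∂_ω a}` over all `ω` is the cyclic submodule generated by `a`: invariant by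
construction and finite-dimensional by the preceding bound. -/
lemma exists_finiteDimensional_del (a : Pol q) : ∃ W : Submodule ℂ (Pol q),
    FiniteDimensional ℂ W ∧ a ∈ W ∧ ∀ (ω : Uq q), ∀ x ∈ W, del ω x ∈ W := by
  obtain ⟨W, hW, hWa⟩ := exists_finiteDimensional_lact a
  let F : Uq q →ₗ[ℂ] Pol q :=
    { toFun := fun ω => del ω a
      map_add' := fun x y => del_add x y a
      map_smul' := fun c x => del_smul c x a }
  have hF : LinearMap.range F ≤ W := by
    rintro _ ⟨ω, rfl⟩
    exact hWa _
  refine ⟨LinearMap.range F, Submodule.finiteDimensional_of_le hF, ⟨1, del_one a⟩, ?_⟩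
  rintro ω _ ⟨η, rfl⟩
  exact ⟨ω * η, del_mul ω η a⟩

lemma exists_finiteDimensional_diracPol (a : PolSpinor q) : ∃ V : Submodule ℂ (PolSpinor q),
    FiniteDimensional ℂ V ∧ a ∈ V ∧ ∀ v ∈ V, diracPol q v ∈ V := by
  obtain ⟨W, hW, haW, hWd⟩ := exists_finiteDimensional_del (a.1 : Pol q)
  obtain ⟨W', hW', haW', hWd'⟩ := exists_finiteDimensional_del (a.2 : Pol q)
  -- The Dirac operator exchanges the two components, so the same invariant space has to serve both.
  have hd : ∀ (ω : Uq q), ∀ x ∈ W ⊔ W', del ω x ∈ W ⊔ W' := by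
    intro ω x hx
    obtain ⟨y, hy, z, hz, rfl⟩ := Submodule.mem_sup.1 hx
    rw [map_add]
    exact add_mem (Submodule.mem_sup_left (hWd ω y hy)) (Submodule.mem_sup_right (hWd' ω z hz))
  let ι : PolSpinor q →ₗ[ℂ] Pol q × Pol q := (wt q 1).subtype.prodMap (wt q (-1)).subtype
  have hι : Function.Injective ι :=
    Function.Injective.prodMap Subtype.val_injective Subtype.val_injective
  refine ⟨((W ⊔ W').prod (W ⊔ W')).comap ι, ?_, ?_, ?_⟩
  · have : FiniteDimensional ℂ ((W ⊔ W').prod (W ⊔ W')) :=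
      Module.Finite.iff_fg.2
        ((Module.Finite.iff_fg.1 inferInstance).prod (Module.Finite.iff_fg.1 inferInstance))
    let g := ι.restrict (p := ((W ⊔ W').prod (W ⊔ W')).comap ι) (q := (W ⊔ W').prod (W ⊔ W'))
      fun x hx => hx
    exact Module.Finite.of_injective g fun x y hxy =>
      Subtype.ext (hι (congrArg Subtype.val hxy))
  · exact ⟨Submodule.mem_sup_left haW, Submodule.mem_sup_right haW'⟩
  · rintro v ⟨hv1, hv2⟩
    exact ⟨hd _ _ hv2, hd _ _ hv1⟩

/-! ### Graphs of the Dirac and Casimir operators -/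

/-- This is closability: the closed graph is the graph of an operator once it contains no `(0, y)`
with `y ≠ 0`, which symmetry ensures. -/
lemma graph_dirac (h : HaarState q) : (dirac h).graph = closedGraph h (diracPol q) :=
  Submodule.toLinearPMap_graph_eq _
    (graphClosure_snd_eq_zero (denseRange_toSpinor h) (inner_diracPol h))

lemma inner_rhoPol_casimir (h : HaarState q) (a b : PolSpinor q) :
    (inner ℂ (toSpinor h (rhoPol (Uq.casimir q) a)) (toSpinor h b) : ℂ) =
      inner ℂ (toSpinor h a) (toSpinor h (rhoPol (Uq.casimir q) b)) := by
  simp only [rhoPol_casimir, LinearMap.comp_apply, inner_diracPol]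

lemma graph_casimirOp (h : HaarState q) :
    (casimirOp h).graph = closedGraph h (rhoPol (Uq.casimir q)) :=
  Submodule.toLinearPMap_graph_eq _
    (graphClosure_snd_eq_zero (denseRange_toSpinor h) (inner_rhoPol_casimir h))

/-- Products as compositions of graphs: equality of `D²` and `C`, domains included, thereby becomes
`mem_graphClosure_sq`. -/
lemma mem_graph_pmapMul {E : Type*} [AddCommGroup E] [Module ℂ E] (S T : E →ₗ.[ℂ] E) (x z : E) :
    (x, z) ∈ (pmapMul S T).graph ↔ ∃ y, (x, y) ∈ T.graph ∧ (y, z) ∈ S.graph := by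
  constructor
  · intro hx
    obtain ⟨⟨w, hw⟩, rfl, rfl⟩ := (LinearPMap.mem_graph_iff _).1 hx
    obtain ⟨hT, hS⟩ := (mem_pmapMul_domain S T w).1 hw
    exact ⟨T ⟨w, hT⟩, T.mem_graph ⟨w, hT⟩, by
      rw [pmapMul_apply S T w hT hS hw]; exact S.mem_graph ⟨_, hS⟩⟩
  · rintro ⟨y, hxy, hyz⟩
    obtain ⟨⟨x, hx⟩, rfl, rfl⟩ := (LinearPMap.mem_graph_iff _).1 hxy
    obtain ⟨y, hy1, hy2⟩ := (LinearPMap.mem_graph_iff _).1 hyz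
    have hy : T ⟨x, hx⟩ ∈ S.domain := by
      have := y.2
      rwa [hy1] at this
    obtain rfl : y = ⟨_, hy⟩ := Subtype.ext hy1
    obtain rfl : S ⟨_, hy⟩ = z := hy2
    have hw : x ∈ (pmapMul S T).domain := (mem_pmapMul_domain S T x).2 ⟨hx, hy⟩
    rw [← pmapMul_apply S T x hx hy hw]
    exact (pmapMul S T).mem_graph ⟨x, hw⟩

instance (h : HaarState q) (n : ℤ) : CompleteSpace (L2w h n) :=
  (Submodule.isClosed_topologicalClosure _).completeSpace_coe

/-- `D² = C`. -/
lemma dirac_mul_dirac (h : HaarState q) : pmapMul (dirac h) (dirac h) = casimirOp h := by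
  refine LinearPMap.eq_of_eq_graph (Submodule.ext fun ⟨x, z⟩ => ?_)
  rw [mem_graph_pmapMul, graph_dirac, graph_casimirOp, rhoPol_casimir]
  exact (mem_graphClosure_sq (denseRange_toSpinor h) (inner_diracPol h)
    exists_finiteDimensional_diracPol x z).symm

/-! ### Commutators -/

/-- The bounded operator `(0, q^{1/2} ∂_e(b); q^{-1/2} ∂_f(b), 0)`. -/
def commOp (h : HaarState q) (b : wt q 0) : Spinor h →L[ℂ] Spinor h :=
  blockOp 0 (qh q • mulOp h (n := -1) (p := 1) (by norm_num) (delE b))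
    ((qh q)⁻¹ • mulOp h (n := 1) (p := -1) (by norm_num) (delF b)) 0

/-- Left multiplication by `b ∈ ℬ` on polynomial spinors. -/
def mulPol (b : wt q 0) (a : PolSpinor q) : PolSpinor q :=
  (⟨b * a.1, mul_mem_wt (zero_add 1) b.2 a.1.2⟩, ⟨b * a.2, mul_mem_wt (zero_add (-1)) b.2 a.2.2⟩)

lemma blockOp_apply {h : HaarState q} (a : L2w h 1 →L[ℂ] L2w h 1) (b : L2w h (-1) →L[ℂ] L2w h 1)
    (c : L2w h 1 →L[ℂ] L2w h (-1)) (d : L2w h (-1) →L[ℂ] L2w h (-1)) (x : Spinor h) :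
    blockOp a b c d x = WithLp.toLp 2 (a x.fst + b x.snd, c x.fst + d x.snd) := rfl

lemma toSpinor_apply (h : HaarState q) (a : PolSpinor q) :
    toSpinor h a = WithLp.toLp 2 (toL2w h 1 a.1, toL2w h (-1) a.2) := rfl

lemma mulOp_toL2w (h : HaarState q) {m n p : ℤ} (hp : m + n = p) (a : wt q m) (x : wt q n) :
    mulOp h hp a (toL2w h n x) = toL2w h p ⟨a * x, mul_mem_wt hp a.2 x.2⟩ :=
  Subtype.ext (leftMul_toL2 h a x)

lemma mulSpinor_toSpinor (h : HaarState q) (b : wt q 0) (a : PolSpinor q) :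
    mulSpinor h b (toSpinor h a) = toSpinor h (mulPol b a) := by
  rw [mulSpinor, blockOp_apply, toSpinor_apply, toSpinor_apply]
  simp only [WithLp.toLp_fst, WithLp.toLp_snd, mulOp_toL2w, zero_apply, add_zero, zero_add]
  rfl

/-- The twisted Leibniz rule with `∂_k(b) = b`; the factors `q^{1/2}` and `q^{-1/2}` are the
eigenvalues of `∂_{k⁻¹}` on `𝒜_{-1}` and `𝒜_1`. -/
lemma commOp_toSpinor (h : HaarState q) (b : wt q 0) (a : PolSpinor q) :
    mulSpinor h b (toSpinor h (diracPol q a)) + commOp h b (toSpinor h a) =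
      toSpinor h (diracPol q (mulPol b a)) := by
  rw [mulSpinor_toSpinor, commOp, blockOp_apply, toSpinor_apply, toSpinor_apply, toSpinor_apply]
  simp only [WithLp.toLp_fst, WithLp.toLp_snd, mulOp_toL2w, zero_apply,
    smul_apply, add_zero, zero_add]
  rw [← map_smul, ← map_smul]
  rw [← WithLp.toLp_add, Prod.mk_add_mk, ← map_add, ← map_add]
  congr 3 <;> apply Subtype.ext
  · change (b : Pol q) * del (Uq.e q) a.2 + qh q • (del (Uq.e q) b * a.2) =
      del (Uq.e q) ((b : Pol q) * a.2)
    rw [del_e_mul, mem_wt.1 b.2, mem_wt_ki a.2.2, zpow_zero, one_smul, zpow_neg_one, inv_inv,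
      mul_smul_comm, add_comm]
  · change (b : Pol q) * del (Uq.f q) a.1 + (qh q)⁻¹ • (del (Uq.f q) b * a.1) =
      del (Uq.f q) ((b : Pol q) * a.1)
    rw [del_f_mul, mem_wt.1 b.2, mem_wt_ki a.1.2, zpow_zero, one_smul, zpow_one,
      mul_smul_comm, add_comm]

/-- Boundedness of `b` and of the commutator makes this a closed condition on the graph, so
polynomial spinors suffice. Domain invariance and the commutator formula come out together. -/
lemma mulSpinor_mem_graph (h : HaarState q) (b : wt q 0) {x : Spinor h × Spinor h}
    (hx : x ∈ (dirac h).graph) :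
    (mulSpinor h b x.1, mulSpinor h b x.2 + commOp h b x.1) ∈ (dirac h).graph := by
  rw [graph_dirac] at hx ⊢
  refine graphClosure_induction (p := fun x =>
    (mulSpinor h b x.1, mulSpinor h b x.2 + commOp h b x.1) ∈ closedGraph h (diracPol q))
    (isClosed_graphClosure.preimage (by fun_prop)) (fun a => ?_) hx
  rw [mulSpinor_toSpinor, commOp_toSpinor]
  exact mem_graphClosure (mulPol b a)

end SUq

end

theorem proposition3p1 (q : SUq.Param) (h : SUq.HaarState q) :
    ((SUq.dirac h).graph = SUq.closedGraph h (SUq.diracPol q) ∧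
      (SUq.casimirOp h).graph = SUq.closedGraph h (SUq.rhoPol (SUq.Uq.casimir q))) ∧
    SUq.pmapMul (SUq.dirac h) (SUq.dirac h) = SUq.casimirOp h ∧
    ∀ (b : SUq.wt q 0) (ξ : (SUq.dirac h).domain),
      ∃ hb : SUq.mulSpinor h b ξ ∈ (SUq.dirac h).domain,
        SUq.dirac h ⟨SUq.mulSpinor h b ξ, hb⟩ - SUq.mulSpinor h b (SUq.dirac h ξ) =
          SUq.blockOp 0
            (SUq.qh q • SUq.mulOp h (n := -1) (p := 1) (by norm_num) (SUq.delE b))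
            ((SUq.qh q)⁻¹ • SUq.mulOp h (n := 1) (p := -1) (by norm_num) (SUq.delF b))
            0 ξ := by
  refine ⟨⟨SUq.graph_dirac h, SUq.graph_casimirOp h⟩, SUq.dirac_mul_dirac h, fun b ξ => ?_⟩
  -- The first coordinate of this graph point gives `b ξ ∈ dom D`, the second the value `D(b ξ) = b
  -- D ξ + [D, b] ξ`.
  have hg := SUq.mulSpinor_mem_graph h b ((SUq.dirac h).mem_graph ξ)
  obtain ⟨⟨y, hy⟩, rfl : y = _, hy2⟩ := (LinearPMap.mem_graph_iff _).1 hg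
  refine ⟨hy, ?_⟩
  rw [hy2, add_sub_cancel_left]
  rfl
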